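/- Let $I$ be a finite set (possibly empty). Let $D^{ch}_{\mathbb{C}^{I|I}}=\mathbb{C}[x_{i,(-n)},\partial_{x_i,(-n)},\xi_{i,(-n)},\partial_{\xi_i,(-n)};\ i\in I,\ n>0]$ be the superpolynomial ring with $x_{i,(-n)},\partial_{x_i,(-n)}$ even and $\xi_{i,(-n)},\partial_{\xi_i,(-n)}$ odd, equipped with its vertex superalgebra structure (the $\beta\gamma$-$bc$-system): the generating fields are $g(z)=\sum_{n\in\mathbb{Z}} g_{(n)}z^{-n-1}$ for $g\in\{x_i,\partial_{x_i},\xi_i,\partial_{\xi_i}\}$, the operator $g_{(-n)}$ ($n>0$) is left multiplication by the variable $g_{(-n)}$, the only nontrivial operator product expansions are $\partial_{x_i}(z)x_i(w)\sim\frac1{z-w}$ and $\partial_{\xi_i}(z)\xi_i(w)\sim\frac1{z-w}$, and the field of a monomial $g^1_{(-n_1)}\cdots g^r_{(-n_r)}$ is the normally ordered product of the fields $\frac1{(n_j-1)!}\partial_z^{n_j-1}g^j(z)$. Write $a_{(n)}$, $n\in\mathbb{Z}$, for the modes of the field of $a$. For every multiplicative set $S\subset\mathbb{C}[\mathbb{C}^I]=\mathbb{C}[x_{i,(-1)},i\in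 I]$ the operators $a_{(n)}$, $a\in D^{ch}_{\mathbb{C}^{I|I}}$, extend to the localization $D^{ch}_{\mathbb{C}^{I|I}}[S^{-1}]$ (the operator $\partial_{x_i,(0)}$ by the quotient rule), and the localizations form a sheaf $\underline{D}^{ch}_{\mathbb{C}^{I|I}}$ on the affine space $\mathbb{C}^I$ with its Zariski topology, on which the operators $a_{(n)}$ act by $\mathbb{C}$-linear sheaf endomorphisms. Let $D^{ch}_{\mathbb{C}^{1|1}}$ be the case of a one-element set and $D^{ch}_{\mathbb{C}^{1|1}}[x_{(-1)}^{-1}]$ its localization at the powers of $x_{(-1)}$. The vertex dual of $D^{ch}_{\mathbb{C}^{I|I}}$ is $$(D^{ch}_{\mathbb{C}^{I|I}})^d=\bigotimes_{i\in I}\bigl(D^{ch}_{\mathbb{C}^{1|1}}[x_{(-1)}^{-1}]/D^{ch}_{\mathbb{C}^{1|1}}\bigr),$$ a $D^{ch}_{\mathbb{C}^{I|I}}$-module on which the fields $x_i(z),\partial_{x_i}(z),\xi_i(z),\partial_{\xi_i}(z)$ act on the $i$-th factor, with the usual sign rule for odd fields (with respect to a fixed linear order on $I$). Let $Z=\{0\}\subset\mathbb{C}^I$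 be the point defined by the ideal $(x_i,\ i\in I)$, let $U=\mathbb{C}^I\setminus\{0\}$, and let $H^k_Z(\mathbb{C}^I,-)$ and $H^k(U,-)$ be the $k$-th right derived functors of the functors of sections supported in $Z$ and of sections over $U$; the operators $a_{(n)}$ act on the cohomology of $\underline{D}^{ch}_{\mathbb{C}^{I|I}}$ by functoriality. (i) For every $I$ there is an isomorphism of $D^{ch}_{\mathbb{C}^{I|I}}$-modules, that is, a $\mathbb{C}$-linear isomorphism commuting with all operators $a_{(n)}$, $a\in D^{ch}_{\mathbb{C}^{I|I}}$, $n\in\mathbb{Z}$, $$(D^{ch}_{\mathbb{C}^{I|I}})^d\cong H^{|I|}_Z(\mathbb{C}^I,\underline{D}^{ch}_{\mathbb{C}^{I|I}}).$$ (ii) If $|I|>1$, there are moreover isomorphisms of $D^{ch}_{\mathbb{C}^{I|I}}$-modules $$(D^{ch}_{\mathbb{C}^{I|I}})^d\cong H^{|I|-1}(U,\underline{D}^{ch}_{\mathbb{C}^{I|I}})\quad\text{and}\quad H^{|I|}_Z(\mathbb{C}^I,\underline{D}^{ch}_{\mathbb{C}^{I|I}})\cong H^{|I|-1}(U,\underline{D}^{ch}_{\mathbb{C}^{I|I}}).$$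 -/

import Mathlib

open CategoryTheory TopologicalSpace Opposite

noncomputable section

namespace ChiralDO

/-! ### Vertex operators (fields) and normally ordered products -/

section Fields

variable {W W' : Type*} [AddCommGroup W] [Module ℂ W] [AddCommGroup W'] [Module ℂ W']

/-- The field `A(z) = ∑ A_(n) z^(-n-1)` with prescribed modes `A_(n)`; for every vector `w`
one needs `A_(n) w = 0` for all large `n`. -/
def ofModes (f : ℤ → Module.End ℂ W) (hf : ∀ w, ∃ N : ℤ, ∀ n, N ≤ n → f n w = 0) :
    VertexOperator ℂ W :=
  VertexOperator.of_coeff (fun k => f (-k - 1)) fun w => by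
    obtain ⟨N, hN⟩ := hf w
    refine ⟨-N, fun k hk => ?_⟩
    by_contra hlt
    exact hk (hN _ (by omega))

lemma ncoeff_ofModes (f : ℤ → Module.End ℂ W) (hf) (n : ℤ) :
    VertexOperator.ncoeff (ofModes f hf) n = f n := by
  simp [ofModes, VertexOperator.ncoeff_of_coeff]

lemma ncoeff_eventually_zero (A : VertexOperator ℂ W) (w : W) :
    ∃ N : ℤ, ∀ n, N ≤ n → VertexOperator.ncoeff A n w = 0 := by
  refine ⟨-((HahnModule.of ℂ).symm (A w)).order, fun n hn => ?_⟩
  exact VertexOperator.ncoeff_eq_zero_of_lt_order A n w (by omega)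

/-- The identity field: its only nonzero mode is the `(-1)`-st one. -/
def idField (W : Type*) [AddCommGroup W] [Module ℂ W] : VertexOperator ℂ W :=
  ofModes (fun n => if n = -1 then LinearMap.id else 0) fun w =>
    ⟨0, fun n hn => by rw [if_neg (by omega)]; rfl⟩

/-- The divided derivative `(1/k!) ∂_z^k A(z)`, with modes `(-1)^k (n choose k) A_(n-k)`. -/
def divDeriv (k : ℕ) (A : VertexOperator ℂ W) : VertexOperator ℂ W :=
  ofModes (fun n => ((-1) ^ k * Ring.choose n k : ℤ) • VertexOperator.ncoeff A (n - k))
    fun w => by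
      obtain ⟨N, hN⟩ := ncoeff_eventually_zero A w
      exact ⟨N + k, fun n hn => by simp [hN (n - k) (by omega)]⟩

lemma finite_support_left (A B : VertexOperator ℂ W) (n : ℤ) (w : W) :
    (Function.support fun j : ℕ => VertexOperator.ncoeff A (-j - 1)
      (VertexOperator.ncoeff B (n + j) w)).Finite := by
  obtain ⟨N, hN⟩ := ncoeff_eventually_zero B w
  refine (Set.finite_Iio (N - n).toNat).subset fun j hj => ?_
  by_contra hlt
  simp only [Set.mem_Iio, not_lt] at hlt
  exact hj (by simp [hN (n + j) (by omega)])

lemma finite_support_right (A B : VertexOperator ℂ W) (n : ℤ) (w : W) :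
    (Function.support fun j : ℕ => VertexOperator.ncoeff B (n - j - 1)
      (VertexOperator.ncoeff A j w)).Finite := by
  obtain ⟨N, hN⟩ := ncoeff_eventually_zero A w
  refine (Set.finite_Iio N.toNat).subset fun j hj => ?_
  by_contra hlt
  simp only [Set.mem_Iio, not_lt] at hlt
  exact hj (by simp [hN j (by omega)])

/-- The `n`-th mode of the normally ordered product `:A(z)B(z):`, namely
`∑_{j<0} A_(j) B_(n-j-1) + ε ∑_{j≥0} B_(n-j-1) A_(j)`, where `ε = (-1)^(|A||B|)`. On every vector
only finitely many summands are nonzero. -/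
def normalOrderMode (ε : ℤ) (A B : VertexOperator ℂ W) (n : ℤ) : Module.End ℂ W where
  toFun w :=
    (∑ᶠ j : ℕ, VertexOperator.ncoeff A (-j - 1) (VertexOperator.ncoeff B (n + j) w)) +
      ε • ∑ᶠ j : ℕ, VertexOperator.ncoeff B (n - j - 1) (VertexOperator.ncoeff A j w)
  map_add' v w := by
    simp only [map_add]
    rw [finsum_add_distrib (finite_support_left A B n v) (finite_support_left A B n w),
      finsum_add_distrib (finite_support_right A B n v) (finite_support_right A B n w), smul_add]
    abel
  map_smul' c w := by
    simp only [map_smul, RingHom.id_apply]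
    rw [← smul_finsum' c (finite_support_left A B n w),
      ← smul_finsum' c (finite_support_right A B n w), smul_add, smul_comm]

/-- The normally ordered product `:A(z)B(z):` with sign `ε = (-1)^(|A||B|)`. -/
def normalOrder (ε : ℤ) (A B : VertexOperator ℂ W) : VertexOperator ℂ W :=
  ofModes (normalOrderMode ε A B) fun w => by
    obtain ⟨N, hN⟩ := ncoeff_eventually_zero B w
    obtain ⟨K, hK⟩ := ncoeff_eventually_zero A w
    have hex : ∀ j : ℕ, ∃ L : ℤ, ∀ n, L ≤ n →
        VertexOperator.ncoeff B n (VertexOperator.ncoeff A j w) = 0 :=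
      fun j => ncoeff_eventually_zero B _
    choose L hL using hex
    obtain ⟨T, hT⟩ : ∃ T : ℤ, ∀ j ∈ Finset.range K.toNat, L j + j + 1 ≤ T := by
      obtain ⟨T, hT⟩ := ((Finset.range K.toNat).image fun j : ℕ => L j + j + 1).bddAbove
      exact ⟨T, fun j hj => hT (Finset.mem_coe.2 (Finset.mem_image_of_mem _ hj))⟩
    refine ⟨max N T, fun n hn => ?_⟩
    have h1 : ∀ j : ℕ, VertexOperator.ncoeff A (-j - 1) (VertexOperator.ncoeff B (n + j) w) = 0 :=
      fun j => by rw [hN (n + j) (by omega), map_zero]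
    have h2 : ∀ j : ℕ, VertexOperator.ncoeff B (n - j - 1) (VertexOperator.ncoeff A j w) = 0 := by
      intro j
      by_cases hj : j < K.toNat
      · have := hT j (Finset.mem_range.2 hj)
        exact hL j _ (by omega)
      · rw [hK j (by omega), map_zero]
    simp [normalOrderMode, h1, h2]

end Fields

/-! ### The superpolynomial space `D^ch` -/

/-- The generating fields `x_i(z)`, `∂_{x_i}(z)` (even) and `ξ_i(z)`, `∂_{ξ_i}(z)` (odd). -/
inductive Gen (I : Type) : Type
  | x (i : I)
  | dx (i : I)
  | xi (i : I)
  | dxi (i : I)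

/-- The parity of a generating field. -/
def Gen.parity {I : Type} : Gen I → ℕ
  | .x _ => 0
  | .dx _ => 0
  | .xi _ => 1
  | .dxi _ => 1

/-- The even variables other than the `x_{i,(-1)}`: the pair `(i, inl k)` is `x_{i,(-k-2)}` and
`(i, inr k)` is `∂_{x_i,(-k-1)}`. -/
abbrev EvenVar (I : Type) : Type := I ×ₗ (ℕ ⊕ₗ ℕ)

/-- The odd variables: the pair `(i, inl k)` is `ξ_{i,(-k-1)}` and `(i, inr k)` is
`∂_{ξ_i,(-k-1)}`. The (lexicographic) order is the one in which the factors of an odd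
monomial are written. -/
abbrev OddVar (I : Type) : Type := I ×ₗ (ℕ ⊕ₗ ℕ)

/-- The variable with index `i` on the left (`inl`) summand. -/
abbrev varL {I : Type} (i : I) (k : ℕ) : I ×ₗ (ℕ ⊕ₗ ℕ) := toLex (i, toLex (Sum.inl k))

/-- The variable with index `i` on the right (`inr`) summand. -/
abbrev varR {I : Type} (i : I) (k : ℕ) : I ×ₗ (ℕ ⊕ₗ ℕ) := toLex (i, toLex (Sum.inr k))

/-- Supermonomials in all the variables except the `x_{i,(-1)}`: exponents of the even variables,
and the finite set of the odd variables that occur. -/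
abbrev SuperMonomial (I : Type) : Type := (EvenVar I →₀ ℕ) × Finset (OddVar I)

/-- The coordinate ring `ℂ[ℂ^I]`, the variable `X i` being `x_{i,(-1)}`. -/
abbrev Coord (I : Type) : Type := MvPolynomial I ℂ

/-- The superpolynomial space
`D^ch_{ℂ^{I|I}} = ℂ[x_{i,(-n)}, ∂_{x_i,(-n)}, ξ_{i,(-n)}, ∂_{ξ_i,(-n)}, n > 0, i ∈ I]`, as the free
module over `ℂ[x_{i,(-1)}, i ∈ I]` on the supermonomials in the other variables. -/
def Dch (I : Type) : Type := SuperMonomial I →₀ Coord I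

instance (I : Type) : AddCommGroup (Dch I) := inferInstanceAs (AddCommGroup (_ →₀ Coord I))

instance (I : Type) : Module (Coord I) (Dch I) :=
  inferInstanceAs (Module (Coord I) (_ →₀ Coord I))

instance (I : Type) : Module ℂ (Dch I) := inferInstanceAs (Module ℂ (_ →₀ Coord I))

instance (I : Type) : IsScalarTower ℂ (Coord I) (Dch I) :=
  inferInstanceAs (IsScalarTower ℂ (Coord I) (_ →₀ Coord I))

/-- The basis of `D^ch` over `ℂ[x_{i,(-1)}, i ∈ I]` given by the supermonomials. -/
def monomialBasis (I : Type) : Module.Basis (SuperMonomial I) (Coord I) (Dch I) :=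
  ⟨LinearEquiv.refl (Coord I) (SuperMonomial I →₀ Coord I)⟩

/-- The basis of `D^ch` over `ℂ` given by the monomials `∏ x_{i,(-1)}^{p i} · b`. -/
def complexBasis (I : Type) : Module.Basis ((I →₀ ℕ) × SuperMonomial I) ℂ (Dch I) :=
  (MvPolynomial.basisMonomials I ℂ).smulTower (monomialBasis I)

variable {I : Type}

/-- Multiplication by an even variable. -/
def evenMul (e : EvenVar I) : Dch I →ₗ[Coord I] Dch I :=
  (monomialBasis I).constr (Coord I) fun b => monomialBasis I (b.1 + Finsupp.single e 1, b.2)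

/-- Partial derivative in an even variable. -/
def evenDer (e : EvenVar I) : Dch I →ₗ[Coord I] Dch I :=
  (monomialBasis I).constr (Coord I) fun b =>
    b.1 e • monomialBasis I (b.1 - Finsupp.single e 1, b.2)

/-! ### Products of generators and their fields -/

/-- The parity of a product of generators; `(g, k)` stands for `g_(-k-1)`. -/
def wordParity (w : List (Gen I × ℕ)) : ℕ := (w.map fun a => a.1.parity).sum

/-- The field of a product of generators `g_(-k-1) g'_(-k'-1) ⋯`: the (right nested) normally
ordered product of the fields `(1/k!) ∂_z^k g(z)`, `(1/k'!) ∂_z^k' g'(z)`, …, where `φ g` is the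
field `g(z)` on `W`. -/
def wordField {W : Type*} [AddCommGroup W] [Module ℂ W] (φ : Gen I → VertexOperator ℂ W) :
    List (Gen I × ℕ) → VertexOperator ℂ W
  | [] => idField W
  | (g, k) :: w =>
      normalOrder ((-1) ^ (g.parity * wordParity w)) (divDeriv k (φ g)) (wordField φ w)

/-- The generator `g_(-k-1)` named by an even variable. -/
def evenGen (e : EvenVar I) : Gen I × ℕ :=
  match ofLex (ofLex e).2 with
  | .inl k => (.x (ofLex e).1, k + 1)
  | .inr k => (.dx (ofLex e).1, k)

/-- The generator `g_(-k-1)` named by an odd variable. -/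
def oddGen (o : OddVar I) : Gen I × ℕ :=
  match ofLex (ofLex o).2 with
  | .inl k => (.xi (ofLex o).1, k)
  | .inr k => (.dxi (ofLex o).1, k)

section Intertwine

variable {W W' : Type*} [AddCommGroup W] [Module ℂ W] [AddCommGroup W'] [Module ℂ W']

lemma wordField_comm (φ : Gen I → VertexOperator ℂ W) (φ' : Gen I → VertexOperator ℂ W')
    (f : W →ₗ[ℂ] W')
    (h : ∀ g n w, f (VertexOperator.ncoeff (φ g) n w) = VertexOperator.ncoeff (φ' g) n (f w))
    (l : List (Gen I × ℕ)) (n : ℤ) (w : W) :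
    f (VertexOperator.ncoeff (wordField φ l) n w) =
      VertexOperator.ncoeff (wordField φ' l) n (f w) := by
  induction l generalizing n w with
  | nil =>
    simp only [wordField, idField, ncoeff_ofModes]
    split_ifs <;> simp
  | cons a l ih =>
    obtain ⟨g, k⟩ := a
    have hA : ∀ n w, f (VertexOperator.ncoeff (divDeriv k (φ g)) n w) =
        VertexOperator.ncoeff (divDeriv k (φ' g)) n (f w) := by
      intro n w
      simp only [divDeriv, ncoeff_ofModes, LinearMap.smul_apply, map_zsmul, h]
    simp only [wordField, normalOrder, ncoeff_ofModes, normalOrderMode, LinearMap.coe_mk,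
      AddHom.coe_mk, map_add, map_zsmul]
    have e1 := (f : W →+ W').map_finsum
      (finite_support_left (divDeriv k (φ g)) (wordField φ l) n w)
    have e2 := (f : W →+ W').map_finsum
      (finite_support_right (divDeriv k (φ g)) (wordField φ l) n w)
    simp only [AddMonoidHom.coe_coe] at e1 e2
    rw [e1, e2]
    simp only [hA, ih]

end Intertwine

/-! ### Localization -/

/-- The localization `D^ch[S⁻¹]` at a multiplicative set `S ⊆ ℂ[ℂ^I]`. -/
abbrev DchLoc (S : Submonoid (Coord I)) : Type := LocalizedModule S (Dch I)

lemma smul_mk (S : Submonoid (Coord I)) (c : ℂ) (m : Dch I) (s : S) :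
    c • (LocalizedModule.mk m s : DchLoc S) = LocalizedModule.mk (c • m) s := by
  rw [← algebraMap_smul (Coord I) c, LocalizedModule.smul'_mk, algebraMap_smul]

/-- The extension of an operator `D` on `D^ch` satisfying the Leibniz rule `D(rm) = δ(r)m + rD(m)`
to the localization, by `D(m/s) = (s D(m) - δ(s) m)/s²`. -/
def extendLoc (S : Submonoid (Coord I)) (δ : Derivation ℂ (Coord I) (Coord I))
    (D : Dch I →ₗ[ℂ] Dch I) (h : ∀ r m, D (r • m) = δ r • m + r • D m) :
    DchLoc S →ₗ[ℂ] DchLoc S where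
  toFun := fun y => LocalizedModule.liftOn y
    (fun p => LocalizedModule.mk ((p.2 : Coord I) • D p.1 - δ p.2 • p.1) (p.2 * p.2)) (by
      rintro ⟨m, s⟩ ⟨m', s'⟩ ⟨u, hu⟩
      refine LocalizedModule.mk_eq.2 ⟨u * u, ?_⟩
      simp only [Submonoid.smul_def, Submonoid.coe_mul] at hu ⊢
      have h2 := congrArg D hu
      simp only [h, smul_add] at h2
      linear_combination (norm := module) ((u : Coord I) * s * s') • h2 -
        (δ u * s * s') • hu - ((u : Coord I) * δ s * s') • hu - ((u : Coord I) * s * δ s') • hu)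
  map_add' y z := by
    induction y using LocalizedModule.induction_on with | _ m s
    induction z using LocalizedModule.induction_on with | _ m' s'
    rw [LocalizedModule.mk_add_mk]
    simp only [LocalizedModule.liftOn_mk]
    rw [LocalizedModule.mk_add_mk]
    refine LocalizedModule.mk_eq.2 ⟨1, ?_⟩
    simp only [Submonoid.smul_def, Submonoid.coe_mul, one_smul, map_add, h,
      Derivation.leibniz, smul_eq_mul]
    module
  map_smul' c y := by
    induction y using LocalizedModule.induction_on with | _ m s
    rw [smul_mk]
    simp only [LocalizedModule.liftOn_mk, RingHom.id_apply]
    rw [smul_mk]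
    simp only [map_smul, smul_sub, smul_comm c]

/-! ### The operators on `D^ch` -/

variable [LinearOrder I]

/-- The sign `(-1)^{#{s ∈ S | s < o}}` from moving the odd variable `o` past the smaller ones. -/
def oddSign (o : OddVar I) (S : Finset (OddVar I)) : ℤ := (-1) ^ (S.filter (· < o)).card

/-- Left multiplication by an odd variable. -/
def oddMul (o : OddVar I) : Dch I →ₗ[Coord I] Dch I :=
  (monomialBasis I).constr (Coord I) fun b =>
    if o ∈ b.2 then 0 else oddSign o b.2 • monomialBasis I (b.1, insert o b.2)

/-- Left partial derivative in an odd variable. -/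
def oddDer (o : OddVar I) : Dch I →ₗ[Coord I] Dch I :=
  (monomialBasis I).constr (Coord I) fun b =>
    if o ∈ b.2 then oddSign o b.2 • monomialBasis I (b.1, b.2.erase o) else 0

/-- The parity operator, `±1` on even and odd monomials. -/
def parityOp (I : Type) : Dch I →ₗ[Coord I] Dch I :=
  (monomialBasis I).constr (Coord I) fun b => ((-1) ^ b.2.card : ℤ) • monomialBasis I b

/-- The modes of the generating fields on `D^ch`. The modes `g_(-n)` with `n > 0` are the
multiplications by the variables; the others are derivatives, as dictated by
`∂_x(z) x(w) ∼ 1/(z-w)`, `∂_ξ(z) ξ(w) ∼ 1/(z-w)`, that is, by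
`[∂_{x_i,(m)}, x_{j,(n)}] = δ_{ij} δ_{m+n,-1} = [∂_{ξ_i,(m)}, ξ_{j,(n)}]_+`. -/
def mode : Gen I → ℤ → (Dch I →ₗ[ℂ] Dch I)
  | .x i, .negSucc 0 => (MvPolynomial.X i : Coord I) • LinearMap.id
  | .x i, .negSucc (k + 1) => (evenMul (varL i k)).restrictScalars ℂ
  | .x i, .ofNat k => -(evenDer (varR i k)).restrictScalars ℂ
  | .dx i, .negSucc k => (evenMul (varR i k)).restrictScalars ℂ
  | .dx i, .ofNat 0 =>
      Finsupp.mapRange.linearMap (MvPolynomial.pderiv (R := ℂ) i : Coord I →ₗ[ℂ] Coord I)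
  | .dx i, .ofNat (k + 1) => (evenDer (varL i k)).restrictScalars ℂ
  | .xi i, .negSucc k => (oddMul (varL i k)).restrictScalars ℂ
  | .xi i, .ofNat k => (oddDer (varR i k)).restrictScalars ℂ
  | .dxi i, .negSucc k => (oddMul (varR i k)).restrictScalars ℂ
  | .dxi i, .ofNat k => (oddDer (varL i k)).restrictScalars ℂ

/-- The derivation of the coordinate ring over which a mode is linear: `∂/∂x_i` for
`∂_{x_i,(0)}`, zero for all other modes, which are linear over the coordinate ring. -/
def modeDer : Gen I → ℤ → Derivation ℂ (Coord I) (Coord I)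
  | .dx i, .ofNat 0 => MvPolynomial.pderiv i
  | _, _ => 0

lemma mode_smul (g : Gen I) (n : ℤ) (r : Coord I) (m : Dch I) :
    mode g n (r • m) = modeDer g n r • m + r • mode g n m := by
  have h0 : ∀ j : Gen I, ∀ k : ℕ, modeDer j (Int.negSucc k) = 0 := by
    rintro (i | i | i | i) k <;> rfl
  have h1 : ∀ i : I, ∀ k : ℕ, modeDer (.dx i) (Int.ofNat (k + 1)) = 0 := fun _ _ => rfl
  rcases g with i | i | i | i <;> rcases n with k | k
  · change -(evenDer (varR i k)) (r • m) = (0 : Coord I) • m + r • -(evenDer (varR i k)) m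
    simp
  · rw [h0]
    cases k <;> simp [mode, smul_comm r]
  · cases k with
    | zero =>
      have key : ∀ m : SuperMonomial I →₀ Coord I,
          Finsupp.mapRange.linearMap (MvPolynomial.pderiv (R := ℂ) i : Coord I →ₗ[ℂ] Coord I)
            (r • m) = MvPolynomial.pderiv i r • m + r • Finsupp.mapRange.linearMap
              (MvPolynomial.pderiv (R := ℂ) i : Coord I →ₗ[ℂ] Coord I) m := by
        intro m
        ext b : 1
        simp
        ring
      exact key m
    | succ k =>
      rw [h1]
      simp [mode]
  · rw [h0]
    simp [mode]
  · change (oddDer (varR i k)) (r • m) = (0 : Coord I) • m + r • (oddDer (varR i k)) m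
    simp
  · rw [h0]
    simp [mode]
  · change (oddDer (varL i k)) (r • m) = (0 : Coord I) • m + r • (oddDer (varL i k)) m
    simp
  · rw [h0]
    simp [mode]

lemma mode_eventually_zero (g : Gen I) (m : Dch I) :
    ∃ N : ℤ, ∀ n, N ≤ n → mode g n m = 0 ∧ modeDer g n = 0 := by
  have key : ∀ T : ℕ → (Dch I →ₗ[Coord I] Dch I),
      (∀ b, ∃ K : ℕ, ∀ k, K ≤ k → T k (monomialBasis I b) = 0) →
      ∃ K : ℕ, ∀ k, K ≤ k → T k m = 0 := by
    intro T hT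
    induction (monomialBasis I).mem_span m using Submodule.span_induction with
    | mem x h =>
      obtain ⟨b, rfl⟩ := h
      exact hT b
    | zero => exact ⟨0, fun k _ => map_zero _⟩
    | add u v _ _ hu hv =>
      obtain ⟨K, hK⟩ := hu
      obtain ⟨L, hL⟩ := hv
      exact ⟨max K L, fun k hk => by
        rw [map_add, hK k (le_trans (le_max_left _ _) hk), hL k (le_trans (le_max_right _ _) hk),
          add_zero]⟩
    | smul a x _ hx =>
      obtain ⟨K, hK⟩ := hx
      exact ⟨K, fun k hk => by rw [map_smul, hK k hk, smul_zero]⟩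
  have evn : ∀ (c : ℕ → EvenVar I), Function.Injective c → ∀ b : SuperMonomial I,
      ∃ K : ℕ, ∀ k, K ≤ k → evenDer (c k) (monomialBasis I b) = 0 := by
    intro c hc b
    have hfin : {k | b.1 (c k) ≠ 0}.Finite := b.1.hasFiniteSupport.preimage hc.injOn
    obtain ⟨K, hK⟩ := hfin.bddAbove
    refine ⟨K + 1, fun k hk => ?_⟩
    have h0 : b.1 (c k) = 0 := by
      by_contra h
      have := hK h
      omega
    simp [evenDer, h0]
  have odn : ∀ (c : ℕ → OddVar I), Function.Injective c → ∀ b : SuperMonomial I,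
      ∃ K : ℕ, ∀ k, K ≤ k → oddDer (c k) (monomialBasis I b) = 0 := by
    intro c hc b
    have hfin : {k | c k ∈ b.2}.Finite := b.2.finite_toSet.preimage hc.injOn
    obtain ⟨K, hK⟩ := hfin.bddAbove
    refine ⟨K + 1, fun k hk => ?_⟩
    have h0 : c k ∉ b.2 := by
      intro h
      have := hK h
      omega
    simp [oddDer, h0]
  have injL : ∀ i : I, Function.Injective fun k => varL i k := by
    intro i k l h
    simpa [varL] using h
  have injR : ∀ i : I, Function.Injective fun k => varR i k := by
    intro i k l h
    simpa [varR] using h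
  rcases g with i | i | i | i
  · obtain ⟨K, hK⟩ := key (fun k => evenDer (varR i k)) (evn _ (injR i))
    refine ⟨K, fun n hn => ?_⟩
    obtain ⟨k, rfl⟩ := Int.eq_ofNat_of_zero_le (le_trans (by omega) hn)
    refine ⟨?_, by cases k <;> rfl⟩
    change -(evenDer (varR i k)) m = 0
    exact neg_eq_zero.2 (hK k (by omega))
  · obtain ⟨K, hK⟩ := key (fun k => evenDer (varL i k)) (evn _ (injL i))
    refine ⟨K + 1, fun n hn => ?_⟩
    obtain ⟨k, rfl⟩ := Int.eq_ofNat_of_zero_le (le_trans (by omega) hn)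
    obtain ⟨l, rfl⟩ : ∃ l, k = l + 1 := ⟨k - 1, by omega⟩
    exact ⟨hK l (by omega), rfl⟩
  · obtain ⟨K, hK⟩ := key (fun k => oddDer (varR i k)) (odn _ (injR i))
    refine ⟨K, fun n hn => ?_⟩
    obtain ⟨k, rfl⟩ := Int.eq_ofNat_of_zero_le (le_trans (by omega) hn)
    exact ⟨hK k (by omega), by cases k <;> rfl⟩
  · obtain ⟨K, hK⟩ := key (fun k => oddDer (varL i k)) (odn _ (injL i))
    refine ⟨K, fun n hn => ?_⟩
    obtain ⟨k, rfl⟩ := Int.eq_ofNat_of_zero_le (le_trans (by omega) hn)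
    exact ⟨hK k (by omega), by cases k <;> rfl⟩

/-! ### State-field correspondence -/

/-- The monomial `∏ x_{i,(-1)}^{p i} · b` written as a product of generators. -/
def monomialWord (p : I →₀ ℕ) (b : SuperMonomial I) : List (Gen I × ℕ) :=
  ((Finsupp.toMultiset p).sort.map fun i => (Gen.x i, 0)) ++
    (Finsupp.toMultiset b.1).sort.map evenGen ++ b.2.sort.map oddGen

/-- The state-field correspondence `a ↦ Y(a, z)` of `D^ch` on a space `W` on which the generating
fields act by `φ`. -/
def field {W : Type*} [AddCommGroup W] [Module ℂ W] (φ : Gen I → VertexOperator ℂ W) :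
    Dch I →ₗ[ℂ] VertexOperator ℂ W :=
  (complexBasis I).constr ℂ fun pb => wordField φ (monomialWord pb.1 pb.2)

/-- The operator `a_(n)` on a space `W` on which the generating fields act by `φ`. -/
abbrev act {W : Type*} [AddCommGroup W] [Module ℂ W] (φ : Gen I → VertexOperator ℂ W)
    (a : Dch I) (n : ℤ) : Module.End ℂ W :=
  VertexOperator.ncoeff (field φ a) n

section Intertwine

variable {W W' : Type*} [AddCommGroup W] [Module ℂ W] [AddCommGroup W'] [Module ℂ W']

lemma act_comm (φ : Gen I → VertexOperator ℂ W) (φ' : Gen I → VertexOperator ℂ W')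
    (f : W →ₗ[ℂ] W')
    (h : ∀ g n w, f (VertexOperator.ncoeff (φ g) n w) = VertexOperator.ncoeff (φ' g) n (f w))
    (a : Dch I) (n : ℤ) (w : W) : f (act φ a n w) = act φ' a n (f w) := by
  induction (complexBasis I).mem_span a using Submodule.span_induction with
  | mem x hx =>
    obtain ⟨pb, rfl⟩ := hx
    simp only [act, field, Module.Basis.constr_basis]
    exact wordField_comm φ φ' f h _ n w
  | zero => simp [act]
  | add u v _ _ hu hv =>
    simp only [act, map_add, Pi.add_apply, LinearMap.add_apply] at *
    rw [hu, hv]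
  | smul c x _ hx =>
    simp only [act, map_smul, Pi.smul_apply, LinearMap.smul_apply] at *
    rw [hx]

end Intertwine

/-! ### The generating fields on localizations -/

/-- The modes of the generating fields on `D^ch[S⁻¹]`. -/
def locMode (S : Submonoid (Coord I)) (g : Gen I) (n : ℤ) : DchLoc S →ₗ[ℂ] DchLoc S :=
  extendLoc S (modeDer g n) (mode g n) (mode_smul g n)

lemma locMode_mk (S : Submonoid (Coord I)) (g : Gen I) (n : ℤ) (m : Dch I) (s : S) :
    locMode S g n (LocalizedModule.mk m s) = LocalizedModule.mk
      ((s : Coord I) • mode g n m - modeDer g n s • m) (s * s) := rfl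

/-- The generating fields on `D^ch[S⁻¹]`. -/
def locField (S : Submonoid (Coord I)) (g : Gen I) : VertexOperator ℂ (DchLoc S) :=
  ofModes (locMode S g) fun y => by
    induction y using LocalizedModule.induction_on with | _ m s
    obtain ⟨N, hN⟩ := mode_eventually_zero g m
    exact ⟨N, fun n hn => by
      rw [locMode_mk, (hN n hn).1, (hN n hn).2]
      simp⟩

/-! ### The vertex dual -/

/-- `D^ch_{ℂ^{1|1}}[x_{(-1)}⁻¹]`. -/
abbrev DchOneLoc : Type := DchLoc (Submonoid.powers (MvPolynomial.X () : Coord Unit))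

/-- The image of `D^ch_{ℂ^{1|1}}` in `D^ch_{ℂ^{1|1}}[x_{(-1)}⁻¹]`. -/
def dchOneRange : Submodule ℂ DchOneLoc :=
  (LinearMap.range (LocalizedModule.mkLinearMap
    (Submonoid.powers (MvPolynomial.X () : Coord Unit)) (Dch Unit))).restrictScalars ℂ

/-- The quotient `D^ch_{ℂ^{1|1}}[x_{(-1)}⁻¹] / D^ch_{ℂ^{1|1}}`. -/
abbrev DchOneQuot : Type := DchOneLoc ⧸ dchOneRange

lemma extendLoc_mem (δ : Derivation ℂ (Coord Unit) (Coord Unit))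
    (D : Dch Unit →ₗ[ℂ] Dch Unit) (h : ∀ r m, D (r • m) = δ r • m + r • D m) :
    dchOneRange ≤ dchOneRange.comap (extendLoc _ δ D h) := by
  rintro _ ⟨m, rfl⟩
  refine ⟨D m, ?_⟩
  change LocalizedModule.mk (D m) 1 = LocalizedModule.mk _ _
  simp

/-- The modes of the generating fields on the quotient. -/
def quotMode (g : Gen Unit) (n : ℤ) : DchOneQuot →ₗ[ℂ] DchOneQuot :=
  dchOneRange.mapQ dchOneRange (locMode _ g n) (extendLoc_mem _ _ _)

/-- The parity operator on the quotient. -/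
def quotParity : DchOneQuot →ₗ[ℂ] DchOneQuot :=
  dchOneRange.mapQ dchOneRange
    (extendLoc _ 0 ((parityOp Unit).restrictScalars ℂ) (by intro r m; simp))
    (extendLoc_mem _ _ _)

lemma quotMode_eventually_zero (g : Gen Unit) (q : DchOneQuot) :
    ∃ N : ℤ, ∀ n, N ≤ n → quotMode g n q = 0 := by
  obtain ⟨y, rfl⟩ := Submodule.Quotient.mk_surjective _ q
  obtain ⟨N, hN⟩ := ncoeff_eventually_zero (locField _ g) y
  refine ⟨N, fun n hn => ?_⟩
  have := hN n hn
  rw [locField, ncoeff_ofModes] at this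
  change Submodule.Quotient.mk (locMode _ g n y) = _
  rw [this, Submodule.Quotient.mk_zero]

/-- The vertex dual `(D^ch_{ℂ^{I|I}})^d = ⨂_{i ∈ I} (D^ch_{ℂ^{1|1}}[x_{(-1)}⁻¹] / D^ch_{ℂ^{1|1}})`. -/
abbrev VertexDual (I : Type) : Type := PiTensorProduct ℂ fun _ : I => DchOneQuot

/-- The index `i` of a generating field. -/
def Gen.index : Gen I → I
  | .x i => i
  | .dx i => i
  | .xi i => i
  | .dxi i => i

/-- The generating field with its index forgotten. -/
def Gen.one : Gen I → Gen Unit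
  | .x _ => .x ()
  | .dx _ => .dx ()
  | .xi _ => .xi ()
  | .dxi _ => .dxi ()

/-- The modes of the generating fields on the vertex dual: a field of index `i` acts on the
`i`-th tensor factor, with the sign rule for odd fields passing the factors `j < i`. -/
def dualMode (g : Gen I) (n : ℤ) : VertexDual I →ₗ[ℂ] VertexDual I :=
  PiTensorProduct.map fun j =>
    if j = g.index then quotMode g.one n
    else if j < g.index then quotParity ^ g.parity
    else LinearMap.id

/-- The generating fields on the vertex dual. -/
def dualField (g : Gen I) : VertexOperator ℂ (VertexDual I) :=
  ofModes (dualMode g) fun t => by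
    induction t using PiTensorProduct.induction_on with
    | smul_tprod r q =>
      obtain ⟨N, hN⟩ := quotMode_eventually_zero g.one (q g.index)
      refine ⟨N, fun n hn => ?_⟩
      rw [map_smul, dualMode, PiTensorProduct.map_tprod,
        (PiTensorProduct.tprod ℂ).map_coord_zero g.index (by simp [hN n hn]), smul_zero]
    | add u v hu hv =>
      obtain ⟨N, hN⟩ := hu
      obtain ⟨K, hK⟩ := hv
      exact ⟨max N K, fun n hn => by
        rw [map_add, hN n (le_trans (le_max_left _ _) hn), hK n (le_trans (le_max_right _ _) hn),
          add_zero]⟩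

/-- The operator `a_(n)`, for `a ∈ D^ch_{ℂ^{I|I}}`, on the vertex dual. -/
def dualAct (a : Dch I) (n : ℤ) : Module.End ℂ (VertexDual I) := act dualField a n

/-! ### The sheaf of chiral differential operators -/

section Comparison

lemma locMode_comp {S T : Submonoid (Coord I)} (f : DchLoc S →ₗ[ℂ] DchLoc T) (hST : S ≤ T)
    (hf : ∀ (m : Dch I) (s : S),
      f (LocalizedModule.mk m s) = LocalizedModule.mk m (⟨s, hST s.2⟩ : T))
    (g : Gen I) (n : ℤ) (y : DchLoc S) : f (locMode S g n y) = locMode T g n (f y) := by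
  induction y using LocalizedModule.induction_on with | _ m s
  rw [locMode_mk, hf, hf, locMode_mk]
  rfl

lemma exists_locMap {J : Type} {S T : Submonoid (Coord J)} (hST : S ≤ T) :
    ∃ f : DchLoc S →ₗ[ℂ] DchLoc T,
      ∀ (m : Dch J) (s : S),
        f (LocalizedModule.mk m s) = LocalizedModule.mk m (⟨s, hST s.2⟩ : T) := by
  have hu : ∀ s : S, IsUnit (algebraMap (Coord J) (Module.End (Coord J) (DchLoc T)) s) :=
    fun s => IsLocalizedModule.map_units (LocalizedModule.mkLinearMap T (Dch J)) ⟨s, hST s.2⟩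
  refine ⟨(LocalizedModule.lift S (LocalizedModule.mkLinearMap T (Dch J)) hu).restrictScalars ℂ,
    fun m s => ?_⟩
  rw [LinearMap.restrictScalars_apply, LocalizedModule.lift_mk]
  refine (Module.End.algebraMap_isUnit_inv_apply_eq_iff (Coord J) (hu s) _ _).2 ?_
  change LocalizedModule.mk m 1 = (s : Coord J) • LocalizedModule.mk m _
  rw [LocalizedModule.smul'_mk]
  refine LocalizedModule.mk_eq.2 ⟨1, ?_⟩
  simp [Submonoid.smul_def]

/-- A mode `a_(n)` sends a fraction `m/s` to a fraction `m'/s'`, uniformly in the localization. -/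
lemma act_fraction (a : Dch I) (n : ℤ) (m : Dch I) (s : Coord I) :
    ∃ (m' : Dch I) (k : ℕ), ∀ (T : Submonoid (Coord I)) (hs : s ∈ T),
      act (locField T) a n (LocalizedModule.mk m ⟨s, hs⟩) =
        LocalizedModule.mk m' ⟨s ^ k, pow_mem hs k⟩ := by
  obtain ⟨⟨m', t, k, rfl⟩, h⟩ : ∃ p : Dch I × Submonoid.powers s,
      LocalizedModule.mk p.1 p.2 =
        act (locField (Submonoid.powers s)) a n
          (LocalizedModule.mk m ⟨s, Submonoid.mem_powers s⟩) := by
    generalize act (locField (Submonoid.powers s)) a n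
          (LocalizedModule.mk m ⟨s, Submonoid.mem_powers s⟩) = y
    induction y using LocalizedModule.induction_on with | _ m s
    exact ⟨(m, s), rfl⟩
  refine ⟨m', k, fun T hs => ?_⟩
  obtain ⟨f, hf⟩ := exists_locMap (Submonoid.powers_le.2 hs)
  have := act_comm (locField (Submonoid.powers s)) (locField T) f (by
    intro g n y
    rw [locField, locField, ncoeff_ofModes, ncoeff_ofModes]
    exact locMode_comp f _ hf g n y) a n (LocalizedModule.mk m ⟨s, Submonoid.mem_powers s⟩)
  rw [← h, hf, hf] at this
  exact this.symm

end Comparison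

/-- The affine space `ℂ^I` with its Zariski topology. -/
abbrev Aff (I : Type) : TopCat := AlgebraicGeometry.PrimeSpectrum.Top (Coord I)

/-- The complement of the prime ideal `p`. -/
abbrev primeCompl (p : PrimeSpectrum (Coord I)) : Submonoid (Coord I) := p.asIdeal.primeCompl

/-- The sections of the sheaf associated with `D^ch` over an open set `V`: the functions
`p ↦ s(p) ∈ D^ch_p` (localization at the prime `p`) that are locally fractions. -/
abbrev DchSections (V : Opens (Aff I)) :
    Submodule ℂ (∀ p : V, AlgebraicGeometry.StructureSheaf.Localizations (Dch I) p.1) :=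
  (AlgebraicGeometry.StructureSheaf.sectionsSubmodule (Dch I) V).restrictScalars ℂ

/-- The underlying presheaf of complex vector spaces. -/
def DchPresheaf (I : Type) : TopCat.Presheaf (ModuleCat.{0} ℂ) (Aff I) where
  obj V := ModuleCat.of ℂ (DchSections V.unop)
  map i := ModuleCat.ofHom
    { toFun := (AlgebraicGeometry.structureSheafInType (Coord I) (Dch I)).obj.map i
      map_add' := fun _ _ => rfl
      map_smul' := fun _ _ => rfl }

lemma DchPresheaf_isSheaf (I : Type) : (DchPresheaf I).IsSheaf := by
  refine (TopCat.Presheaf.isSheaf_iff_isSheaf_comp (CategoryTheory.forget _) _).2 ?_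
  have e : (AlgebraicGeometry.structureSheafInType (Coord I) (Dch I)).obj ≅
      DchPresheaf I ⋙ CategoryTheory.forget _ :=
    NatIso.ofComponents
      (fun V => (Equiv.refl (DchSections (I := I) V.unop)).toIso) (fun _ => rfl)
  exact TopCat.Presheaf.isSheaf_of_iso e
    (AlgebraicGeometry.structureSheafInType (Coord I) (Dch I)).property

/-- The sheaf `D^ch` on `ℂ^I` of complex vector spaces. Its stalk at `p` is the localization of
`D^ch_{ℂ^{I|I}}` at `p`, and its sections over `{f ≠ 0}` are `D^ch_{ℂ^{I|I}}[f⁻¹]`. -/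
def DchSheaf (I : Type) : TopCat.Sheaf (ModuleCat.{0} ℂ) (Aff I) :=
  ⟨DchPresheaf I, DchPresheaf_isSheaf I⟩

/-- The operator `a_(n)`, for `a ∈ D^ch_{ℂ^{I|I}}`, on the sections over `V`. It acts on the values
in the localizations. -/
def sectionAct (a : Dch I) (n : ℤ) (V : Opens (Aff I)) : DchSections V →ₗ[ℂ] DchSections V where
  toFun s := ⟨fun p => act (locField (primeCompl p.1)) a n (s.1 p), fun p => by
    obtain ⟨O, hp, i, m, f, hs⟩ := s.2 p
    obtain ⟨m', k, h⟩ := act_fraction a n m f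
    refine ⟨O, hp, i, m', f ^ k, fun q => ?_⟩
    obtain ⟨hf, hq⟩ := hs q
    refine ⟨pow_mem (S := primeCompl q.1) hf k, ?_⟩
    exact (congrArg (act (locField (primeCompl q.1)) a n) hq).trans (h (primeCompl q.1) hf)⟩
  map_add' s t := by
    ext p
    exact map_add _ _ _
  map_smul' c s := by
    ext p
    exact (act (locField (primeCompl p.1)) a n).map_smul c (s.1 p)

/-- The operator `a_(n)`, for `a ∈ D^ch_{ℂ^{I|I}}`, as an endomorphism of the sheaf `D^ch`. -/
def sheafAct (a : Dch I) (n : ℤ) : DchSheaf I ⟶ DchSheaf I :=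
  ObjectProperty.homMk
    { app := fun V => ModuleCat.ofHom (sectionAct a n V.unop)
      naturality := fun _ _ _ => rfl }

/-! ### Cohomology, and cohomology with support -/

section Cohomology

variable {X : TopCat.{0}}

/-- The functor `F ↦ Γ(V, F)` on sheaves of complex vector spaces. -/
def sections (V : Opens X) : TopCat.Sheaf (ModuleCat.{0} ℂ) X ⥤ ModuleCat.{0} ℂ :=
  TopCat.Sheaf.forget _ X ⋙ (CategoryTheory.evaluation _ _).obj (op V)

instance (V : Opens X) : (sections V).Additive where
  map_add := rfl

/-- The functor `F ↦ Γ_Z(X, F)` of global sections supported in the closed set `Z`, that is,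
restricting to zero on the complement of `Z`. -/
def sectionsSupp (Z : Closeds X) : TopCat.Sheaf (ModuleCat.{0} ℂ) X ⥤ ModuleCat.{0} ℂ where
  obj F := ModuleCat.of ℂ (LinearMap.ker
    (F.obj.map (homOfLE le_top : Z.compl ⟶ (⊤ : Opens X)).op).hom)
  map {F G} φ := ModuleCat.ofHom ((φ.hom.app (op ⊤)).hom.restrict fun s hs => by
    have := congrArg (fun h => h.hom s)
      (φ.hom.naturality (homOfLE le_top : Z.compl ⟶ (⊤ : Opens X)).op)
    rw [LinearMap.mem_ker] at hs ⊢
    have h2 : (G.obj.map (homOfLE le_top : Z.compl ⟶ (⊤ : Opens X)).op).hom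
        ((φ.hom.app (op ⊤)).hom s) = (φ.hom.app (op Z.compl)).hom
          ((F.obj.map (homOfLE le_top : Z.compl ⟶ (⊤ : Opens X)).op).hom s) := this.symm
    rw [h2, hs, map_zero])

instance (Z : Closeds X) : (sectionsSupp Z).Additive where
  map_add := rfl

/-- The sheaf cohomology functor `H^k(V, -)`, the `k`-th right derived functor of `Γ(V, -)`. -/
def coh (V : Opens X) (k : ℕ) : TopCat.Sheaf (ModuleCat.{0} ℂ) X ⥤ ModuleCat.{0} ℂ :=
  (sections V).rightDerived k

/-- The local cohomology functor `H^k_Z(X, -)`, the `k`-th right derived functor of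
`Γ_Z(X, -)`. -/
def localCoh (Z : Closeds X) (k : ℕ) : TopCat.Sheaf (ModuleCat.{0} ℂ) X ⥤ ModuleCat.{0} ℂ :=
  (sectionsSupp Z).rightDerived k

end Cohomology

/-- The closed point `Z = {0}` of `ℂ^I`, defined by the ideal `(x_i, i ∈ I)`. -/
def origin (I : Type) : Closeds (Aff I) :=
  ⟨PrimeSpectrum.zeroLocus (Set.range (MvPolynomial.X : I → Coord I)),
    PrimeSpectrum.isClosed_zeroLocus _⟩

/-- `U = ℂ^I ∖ {0}`. -/
def punctured (I : Type) : Opens (Aff I) := (origin I).compl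

/-- The local cohomology `H^k_Z(ℂ^I, D^ch)`. -/
abbrev LocalCohDch (I : Type) (k : ℕ) : Type := (localCoh (origin I) k).obj (DchSheaf I)

/-- The operator `a_(n)` on `H^k_Z(ℂ^I, D^ch)`, induced by functoriality. -/
def localCohAct (k : ℕ) (a : Dch I) (n : ℤ) : Module.End ℂ (LocalCohDch I k) :=
  ((localCoh (origin I) k).map (sheafAct a n)).hom

/-- The cohomology `H^k(U, D^ch)`. -/
abbrev CohDch (I : Type) (k : ℕ) : Type := (coh (punctured I) k).obj (DchSheaf I)

/-- The operator `a_(n)` on `H^k(U, D^ch)`, induced by functoriality. -/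
def cohAct (k : ℕ) (a : Dch I) (n : ℤ) : Module.End ℂ (CohDch I k) :=
  ((coh (punctured I) k).map (sheafAct a n)).hom

/-- Two vector spaces with operators `a_(n)`, `a ∈ D^ch_{ℂ^{I|I}}`, `n ∈ ℤ`, are isomorphic as
`D^ch_{ℂ^{I|I}}`-modules. -/
def ModuleIso {W W' : Type} [AddCommMonoid W] [Module ℂ W] [AddCommMonoid W'] [Module ℂ W']
    (ρ : Dch I → ℤ → Module.End ℂ W) (ρ' : Dch I → ℤ → Module.End ℂ W') : Prop :=
  ∃ e : W ≃ₗ[ℂ] W', ∀ a n w, e (ρ a n w) = ρ' a n (e w)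

end ChiralDO

end

/-! Both sides are quotients of one space, `D^ch` localized at the product of the coordinates, by
one subspace: the span of the fractions without pole along some coordinate hyperplane. Both quotient
maps commute with all `a_(n)`, so they induce the isomorphism (`moduleIso_of_surjective`).

On the side of the vertex dual, `toDual` sends `∏ x_i^(p_i - N) b` to the tensor product of the
classes of `x^(p_i - N) b_i`, where `b_i` collects the variables of index `i`. This is zero as soon
as some `p_i ≥ N`; for fixed `N` the remaining monomials go to distinct basis vectors, which
determines the kernel. Odd variables are ordered by index first, so reordering signs factor into the
sign rule between tensor factors and the sign inside one factor (`oddSign_place`). Together with the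
quotient rule this shows that `toDual` commutes with the generating fields (`toDual_locMode`), and
`act_comm` passes to the field of an arbitrary `a`.

On the cohomological side, let `U i` be the locus `x_i ≠ 0`. Injective sheaves are flasque, so
sections over `V` vanishing on the `U i`, `i ∈ l`, sit in functor sequences that are short exact on
injectives and add one `U i` at a time. Composing the connecting maps gives a natural map from
sections over the intersection of the `U i` to local cohomology. It is surjective, with kernel
spanned by the sections extending over the intersection of all but one `U i`
(`iteratedδ_surjective_and_ker`), because `D^ch` has no higher cohomology on basic open sets. The
`a_(n)` are not linear over the functions, so cohomology is taken in sheaves of complex vector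
spaces; the vanishing then comes from a partition of unity (`sectionsDecompose_dchSheaf`) propagated
along an injective resolution (`KernelDecomposes.succ`). Commutation with `a_(n)` is naturality in
the sheaf.

Part (ii) follows from the sequence relating sections supported in `Z`, global sections and sections
over `U`, since affine space has no higher cohomology with values in `D^ch`. -/

noncomputable section

namespace ChiralDO

/-! ### Long exact sequences of right derived functors -/

section DerivedSequence

open Limits

universe v u w w'

variable {C : Type u} [Category.{v} C] [Abelian C] [HasInjectiveResolutions C]
  {D : Type w} [Category.{w'} D] [Abelian D]

/-- The cohomology of a functor applied to the chosen injective resolution. -/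
def resHomology (G : C ⥤ D) [G.Additive] (k : ℕ) (X : C) : D :=
  HomologicalComplex.homology
    ((G.mapHomologicalComplex (ComplexShape.up ℕ)).obj (injectiveResolution X).cocomplex) k

/-- The right derived functor computed by the chosen injective resolution. -/
def resIso (G : C ⥤ D) [G.Additive] (k : ℕ) (X : C) :
    (G.rightDerived k).obj X ≅ resHomology G k X :=
  (injectiveResolution X).isoRightDerivedObj G k

/-- The map induced by a morphism of objects. -/
def resMap (G : C ⥤ D) [G.Additive] (k : ℕ) {X Y : C} (f : X ⟶ Y) :
    resHomology G k X ⟶ resHomology G k Y :=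
  HomologicalComplex.homologyMap ((G.mapHomologicalComplex (ComplexShape.up ℕ)).map
    (InjectiveResolution.desc f (injectiveResolution Y) (injectiveResolution X))) k

/-- The map induced by a morphism of functors. -/
def resNat {G G' : C ⥤ D} [G.Additive] [G'.Additive] (α : G ⟶ G') (k : ℕ) (X : C) :
    resHomology G k X ⟶ resHomology G' k X :=
  HomologicalComplex.homologyMap ((NatTrans.mapHomologicalComplex α (ComplexShape.up ℕ)).app
    (injectiveResolution X).cocomplex) k

/-- This formula and the next reduce identities between derived functors to identities on the chosen
resolution, where the snake lemma applies. -/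
lemma rightDerived_map_eq_resMap (G : C ⥤ D) [G.Additive] (k : ℕ) {X Y : C} (f : X ⟶ Y) :
    (G.rightDerived k).map f = (resIso G k X).hom ≫ resMap G k f ≫ (resIso G k Y).inv :=
  Functor.rightDerived_map_eq G k f _ (InjectiveResolution.desc_commutes _ _ _)

lemma rightDerived_app_eq_resNat {G G' : C ⥤ D} [G.Additive] [G'.Additive] (α : G ⟶ G') (k : ℕ)
    (X : C) :
    (NatTrans.rightDerived α k).app X = (resIso G k X).hom ≫ resNat α k X ≫ (resIso G' k X).inv :=
  InjectiveResolution.rightDerived_app_eq α (injectiveResolution X) k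

/-- A sequence of additive functors `A ⟶ B ⟶ E` that is short exact on injective objects. -/
structure InjectiveTriple (C : Type u) [Category.{v} C] [Abelian C]
    (D : Type w) [Category.{w'} D] [Abelian D] where
  A : C ⥤ D
  B : C ⥤ D
  E : C ⥤ D
  [addA : A.Additive]
  [addB : B.Additive]
  [addE : E.Additive]
  α : A ⟶ B
  β : B ⟶ E
  zero : α ≫ β = 0
  -- Injective objects suffice: the sequence is only ever applied to the terms of an injective
  -- resolution.
  exact : ∀ (J : C) [Injective J],
    (ShortComplex.mk (α.app J) (β.app J) (by rw [← NatTrans.comp_app, zero]; rfl)).ShortExact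

namespace InjectiveTriple

attribute [instance] addA addB addE

variable (T T' : InjectiveTriple C D)

/-- The short complex of complexes obtained from a complex. -/
def complexes (K : CochainComplex C ℕ) : ShortComplex (CochainComplex D ℕ) :=
  ShortComplex.mk ((NatTrans.mapHomologicalComplex T.α (ComplexShape.up ℕ)).app K)
    ((NatTrans.mapHomologicalComplex T.β (ComplexShape.up ℕ)).app K) (by
      ext n
      change (T.α ≫ T.β).app (K.X n) = 0
      rw [T.zero]; rfl)

lemma complexes_shortExact (K : CochainComplex C ℕ) (hK : ∀ n, Injective (K.X n)) :
    (T.complexes K).ShortExact :=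
  HomologicalComplex.shortExact_of_degreewise_shortExact _ fun n => by
    have := hK n
    exact T.exact (K.X n)

/-- The short complex of complexes is functorial in the complex. -/
def complexesMap {K L : CochainComplex C ℕ} (f : K ⟶ L) : T.complexes K ⟶ T.complexes L where
  τ₁ := (T.A.mapHomologicalComplex _).map f
  τ₂ := (T.B.mapHomologicalComplex _).map f
  τ₃ := (T.E.mapHomologicalComplex _).map f
  comm₁₂ := ((NatTrans.mapHomologicalComplex T.α (ComplexShape.up ℕ)).naturality f)
  comm₂₃ := ((NatTrans.mapHomologicalComplex T.β (ComplexShape.up ℕ)).naturality f)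

variable {T T'} in
/-- A morphism of sequences of functors. -/
structure Hom (T T' : InjectiveTriple C D) where
  a : T.A ⟶ T'.A
  b : T.B ⟶ T'.B
  e : T.E ⟶ T'.E
  comm_left : a ≫ T'.α = T.α ≫ b
  comm_right : b ≫ T'.β = T.β ≫ e

variable {T T'} in
/-- The morphism of short complexes of complexes induced by a morphism of functors. -/
def Hom.complexes (φ : Hom T T') (K : CochainComplex C ℕ) : T.complexes K ⟶ T'.complexes K where
  τ₁ := (NatTrans.mapHomologicalComplex φ.a _).app K
  τ₂ := (NatTrans.mapHomologicalComplex φ.b _).app K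
  τ₃ := (NatTrans.mapHomologicalComplex φ.e _).app K
  comm₁₂ := by
    ext n
    exact congrArg (fun t => t.app (K.X n)) φ.comm_left
  comm₂₃ := by
    ext n
    exact congrArg (fun t => t.app (K.X n)) φ.comm_right

lemma shortExact_resolution (X : C) :
    (T.complexes (injectiveResolution X).cocomplex).ShortExact :=
  T.complexes_shortExact _ fun n => (injectiveResolution X).injective n

/-- The connecting morphism on the chosen injective resolution. -/
def resδ (k : ℕ) (X : C) : resHomology T.E k X ⟶ resHomology T.A (k + 1) X :=
  (T.shortExact_resolution X).δ k (k + 1) rfl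

/-- Naturality in the object is what makes the connecting maps commute with the operators `a_(n)`.
Naturality in the sequence of functors, proved below, serves instead to compare different open sets.
-/
lemma resδ_naturality (k : ℕ) {X Y : C} (f : X ⟶ Y) :
    T.resδ k X ≫ resMap T.A (k + 1) f = resMap T.E k f ≫ T.resδ k Y :=
  HomologicalComplex.HomologySequence.δ_naturality
    (T.complexesMap (InjectiveResolution.desc f (injectiveResolution Y)
      (injectiveResolution X))) (T.shortExact_resolution X) (T.shortExact_resolution Y)
      k (k + 1) rfl

variable {T T'} in
lemma Hom.resδ_naturality (φ : Hom T T') (k : ℕ) (X : C) :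
    T.resδ k X ≫ resNat φ.a (k + 1) X = resNat φ.e k X ≫ T'.resδ k X :=
  HomologicalComplex.HomologySequence.δ_naturality
    (φ.complexes (injectiveResolution X).cocomplex)
    (T.shortExact_resolution X) (T'.shortExact_resolution X) k (k + 1) rfl

lemma resNat_comp_resδ (k : ℕ) (X : C) : resNat T.β k X ≫ T.resδ k X = 0 :=
  (T.shortExact_resolution X).comp_δ k (k + 1) rfl

lemma resδ_comp_resNat (k : ℕ) (X : C) : T.resδ k X ≫ resNat T.α (k + 1) X = 0 :=
  (T.shortExact_resolution X).δ_comp k (k + 1) rfl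

lemma res_exact_E (k : ℕ) (X : C) : (ShortComplex.mk _ _ (T.resNat_comp_resδ k X)).Exact :=
  (T.shortExact_resolution X).homology_exact₃ k (k + 1) rfl

lemma res_exact_A (k : ℕ) (X : C) : (ShortComplex.mk _ _ (T.resδ_comp_resNat k X)).Exact :=
  (T.shortExact_resolution X).homology_exact₁ k (k + 1) rfl

/-- The connecting morphism. -/
def δ (k : ℕ) : T.E.rightDerived k ⟶ T.A.rightDerived (k + 1) where
  app X := (resIso T.E k X).hom ≫ T.resδ k X ≫ (resIso T.A (k + 1) X).inv
  naturality {X Y} f := by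
    simp only [rightDerived_map_eq_resMap, Category.assoc, Iso.inv_hom_id_assoc]
    rw [← Category.assoc (resMap _ _ _), ← T.resδ_naturality, Category.assoc]

lemma δ_app (k : ℕ) (X : C) : (T.δ k).app X =
    (resIso T.E k X).hom ≫ T.resδ k X ≫ (resIso T.A (k + 1) X).inv := rfl

variable {T T'} in
lemma Hom.δ_naturality (φ : Hom T T') (k : ℕ) :
    NatTrans.rightDerived φ.e k ≫ T'.δ k = T.δ k ≫ NatTrans.rightDerived φ.a (k + 1) := by
  ext X
  simp only [NatTrans.comp_app, rightDerived_app_eq_resNat, δ_app, Category.assoc,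
    Iso.inv_hom_id_assoc]
  rw [← Category.assoc (resNat _ _ _), ← φ.resδ_naturality, Category.assoc]

lemma comp_δ (k : ℕ) (X : C) :
    (NatTrans.rightDerived T.β k).app X ≫ (T.δ k).app X = 0 := by
  simp only [rightDerived_app_eq_resNat, δ_app, Category.assoc, Iso.inv_hom_id_assoc]
  rw [← Category.assoc (resNat _ _ _), T.resNat_comp_resδ, zero_comp, comp_zero]

lemma δ_comp (k : ℕ) (X : C) :
    (T.δ k).app X ≫ (NatTrans.rightDerived T.α (k + 1)).app X = 0 := by
  simp only [rightDerived_app_eq_resNat, δ_app, Category.assoc, Iso.inv_hom_id_assoc]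
  rw [← Category.assoc (T.resδ _ _), T.resδ_comp_resNat, zero_comp, comp_zero]

lemma exact_E (k : ℕ) (X : C) : (ShortComplex.mk _ _ (T.comp_δ k X)).Exact := by
  refine (ShortComplex.exact_iff_of_iso ?_).1 (T.res_exact_E k X)
  refine ShortComplex.isoMk (resIso T.B k X).symm (resIso T.E k X).symm
    (resIso T.A (k + 1) X).symm ?_ ?_
  · simp [rightDerived_app_eq_resNat]
  · simp [δ_app]

lemma exact_A (k : ℕ) (X : C) : (ShortComplex.mk _ _ (T.δ_comp k X)).Exact := by
  refine (ShortComplex.exact_iff_of_iso ?_).1 (T.res_exact_A k X)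
  refine ShortComplex.isoMk (resIso T.E k X).symm (resIso T.A (k + 1) X).symm
    (resIso T.B (k + 1) X).symm ?_ ?_
  · simp [δ_app]
  · simp [rightDerived_app_eq_resNat]

end InjectiveTriple

end DerivedSequence

/-! ### Sections, restriction, flasqueness of injective sheaves -/

section Flasque

variable {X : TopCat.{0}}

/-- Sections of a sheaf of complex vector spaces. -/
abbrev Sec (F : TopCat.Sheaf (ModuleCat.{0} ℂ) X) (V : Opens X) : Type := (sections V).obj F

/-- The map on sections induced by a morphism of sheaves. -/
abbrev secMap {F G : TopCat.Sheaf (ModuleCat.{0} ℂ) X} (φ : F ⟶ G) (V : Opens X) :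
    Sec F V →ₗ[ℂ] Sec G V := ((sections V).map φ).hom

/-- Restriction of sections, as a transformation of functors. -/
def resNatTrans {U V : Opens X} (h : U ≤ V) : sections V ⟶ sections (X := X) U :=
  Functor.whiskerLeft (TopCat.Sheaf.forget _ X) ((evaluation _ _).map (homOfLE h).op)

/-- Restriction of sections. -/
def res (F : TopCat.Sheaf (ModuleCat.{0} ℂ) X) {U V : Opens X} (h : U ≤ V) :
    Sec F V →ₗ[ℂ] Sec F U := ((resNatTrans h).app F).hom

lemma resNatTrans_comp {U V W : Opens X} (h : U ≤ V) (h' : V ≤ W) :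
    resNatTrans h' ≫ resNatTrans h = resNatTrans (h.trans h') := by
  ext F : 2
  exact (F.obj.map_comp _ _).symm

lemma resNatTrans_self {V : Opens X} (h : V ≤ V) : resNatTrans h = 𝟙 _ := by
  ext F : 2
  exact F.obj.map_id _

lemma res_res (F : TopCat.Sheaf (ModuleCat.{0} ℂ) X) {U V W : Opens X} (h : U ≤ V)
    (h' : V ≤ W) (s : Sec F W) : res F h (res F h' s) = res F (h.trans h') s :=
  congrArg (fun t => (t.app F).hom s) (resNatTrans_comp h h')

lemma res_self (F : TopCat.Sheaf (ModuleCat.{0} ℂ) X) {U : Opens X} (h : U ≤ U)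
    (s : Sec F U) : res F h s = s :=
  congrArg (fun t => (t.app F).hom s) (resNatTrans_self h)

lemma secMap_res {F G : TopCat.Sheaf (ModuleCat.{0} ℂ) X} (φ : F ⟶ G) {U V : Opens X} (h : U ≤ V)
    (s : Sec F V) : secMap φ U (res F h s) = res G h (secMap φ V s) :=
  (congrArg (fun f => f.hom s) ((resNatTrans h).naturality φ)).symm

lemma secMap_comp {F G H : TopCat.Sheaf (ModuleCat.{0} ℂ) X} (φ : F ⟶ G) (ψ : G ⟶ H) (V : Opens X)
    (s : Sec F V) : secMap (φ ≫ ψ) V s = secMap ψ V (secMap φ V s) := rfl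

/-- The presheaf of vector spaces freely generated by a section over `U`. -/
def freeOn (U : Opens X) : (Opens X)ᵒᵖ ⥤ ModuleCat.{0} ℂ where
  obj W := ModuleCat.of ℂ ((W.unop ⟶ U) →₀ ℂ)
  map f := ModuleCat.ofHom (Finsupp.lmapDomain ℂ ℂ fun i => f.unop ≫ i)
  map_id W := by
    ext i : 3
    simp
  map_comp f g := by
    ext i : 3
    simp

/-- The generator of the free presheaf. -/
def freeGen {U : Opens X} {W : (Opens X)ᵒᵖ} (i : W.unop ⟶ U) : (freeOn U).obj W :=
  (Finsupp.single i 1 : (W.unop ⟶ U) →₀ ℂ)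

lemma freeOn_map_gen {U : Opens X} {W W' : (Opens X)ᵒᵖ} (f : W ⟶ W') (i : W.unop ⟶ U) :
    ((freeOn U).map f).hom (freeGen i) = freeGen (f.unop ≫ i) :=
  Finsupp.mapDomain_single

lemma freeOn_hom_ext {U : Opens X} {W : (Opens X)ᵒᵖ} {M : ModuleCat.{0} ℂ}
    {f g : (freeOn U).obj W ⟶ M} (h : ∀ i, f.hom (freeGen i) = g.hom (freeGen i)) : f = g :=
  ModuleCat.hom_ext (Finsupp.lhom_ext' fun i => LinearMap.ext_ring (h i))

/-- The map of free presheaves induced by an inclusion, on sections. -/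
def freeOnMapApp {U V : Opens X} (h : U ≤ V) (W : (Opens X)ᵒᵖ) :
    (freeOn U).obj W ⟶ (freeOn V).obj W :=
  ModuleCat.ofHom (Finsupp.lmapDomain ℂ ℂ fun i => i ≫ homOfLE h)

lemma freeOnMapApp_gen {U V : Opens X} (h : U ≤ V) (W : (Opens X)ᵒᵖ) (i : W.unop ⟶ U) :
    (freeOnMapApp h W).hom (freeGen i) = freeGen (i ≫ homOfLE h) :=
  Finsupp.mapDomain_single

/-- The map of free presheaves induced by an inclusion. -/
def freeOnMap {U V : Opens X} (h : U ≤ V) : freeOn U ⟶ freeOn V where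
  app W := freeOnMapApp h W
  naturality W W' f := freeOn_hom_ext fun i => by
    rw [ModuleCat.hom_comp, ModuleCat.hom_comp, LinearMap.comp_apply, LinearMap.comp_apply,
      freeOn_map_gen, freeOnMapApp_gen, freeOnMapApp_gen, freeOn_map_gen]
    rfl

/-- There is at most one inclusion between two open sets, so the map on generators is injective. -/
instance {U V : Opens X} (h : U ≤ V) : Mono (freeOnMap h) := by
  have : ∀ W, Mono ((freeOnMap h).app W) := by
    intro W
    rw [ModuleCat.mono_iff_injective]
    exact Finsupp.mapDomain_injective (fun a b _ => Subsingleton.elim a b)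
  exact NatTrans.mono_of_mono_app _

/-- The map from a free presheaf given by a section, on sections. -/
def freeOnDescApp (F : (Opens X)ᵒᵖ ⥤ ModuleCat.{0} ℂ) (U : Opens X) (s : F.obj (op U))
    (W : (Opens X)ᵒᵖ) : (freeOn U).obj W ⟶ F.obj W :=
  ModuleCat.ofHom (Finsupp.linearCombination ℂ fun i : W.unop ⟶ U => (F.map i.op).hom s)

lemma freeOnDescApp_gen (F : (Opens X)ᵒᵖ ⥤ ModuleCat.{0} ℂ) (U : Opens X) (s : F.obj (op U))
    (W : (Opens X)ᵒᵖ) (i : W.unop ⟶ U) :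
    (freeOnDescApp F U s W).hom (freeGen i) = (F.map i.op).hom s :=
  (Finsupp.linearCombination_single ℂ _ _).trans (one_smul _ _)

/-- The map from a free presheaf given by a section. -/
def freeOnDesc (F : (Opens X)ᵒᵖ ⥤ ModuleCat.{0} ℂ) (U : Opens X) (s : F.obj (op U)) :
    freeOn U ⟶ F where
  app W := freeOnDescApp F U s W
  naturality W W' f := freeOn_hom_ext fun i => by
    rw [ModuleCat.hom_comp, ModuleCat.hom_comp, LinearMap.comp_apply, LinearMap.comp_apply,
      freeOn_map_gen, freeOnDescApp_gen, freeOnDescApp_gen]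
    exact congrArg (fun t => t.hom s) (F.map_comp i.op f)

/-- A section over `U` is a map from the free presheaf on `U`. Injectivity extends it to the free
presheaf on `V`, and the image of the generator there is the required extension. -/
lemma map_surjective_of_injective (F : (Opens X)ᵒᵖ ⥤ ModuleCat.{0} ℂ) [Injective F]
    {U V : Opens X} (h : U ≤ V) : Function.Surjective (F.map (homOfLE h).op).hom := by
  intro s
  let φ := Injective.factorThru (freeOnDesc F U s) (freeOnMap h)
  have hφ : freeOnMap h ≫ φ = freeOnDesc F U s := Injective.comp_factorThru _ _
  refine ⟨(φ.app (op V)).hom (freeGen (𝟙 V)), ?_⟩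
  have h1 : (φ.app (op U)).hom (((freeOn V).map (homOfLE h).op).hom (freeGen (𝟙 V))) =
      (F.map (homOfLE h).op).hom ((φ.app (op V)).hom (freeGen (𝟙 V))) :=
    congrArg (fun t => t.hom (freeGen (𝟙 V))) (φ.naturality (homOfLE h).op)
  have h2 : (φ.app (op U)).hom ((freeOnMapApp h (op U)).hom (freeGen (𝟙 U))) =
      (freeOnDescApp F U s (op U)).hom (freeGen (𝟙 U)) :=
    congrArg (fun t => (t.app (op U)).hom (freeGen (𝟙 U))) hφ
  have h3 : (F.map (𝟙 U).op).hom s = s := congrArg (fun t => t.hom s) (F.map_id (op U))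
  rw [freeOnMapApp_gen, freeOnDescApp_gen, h3] at h2
  rw [freeOn_map_gen] at h1
  exact h1.symm.trans h2

/-- Restriction maps of injective sheaves are surjective. -/
lemma res_surjective_of_injective (J : TopCat.Sheaf (ModuleCat.{0} ℂ) X) (hJ : Injective J)
    {U V : Opens X} (h : U ≤ V) : Function.Surjective (res J h) := by
  -- The inclusion of sheaves into presheaves is right adjoint to sheafification, which preserves
  -- monomorphisms, so it preserves injectives.
  have hJ : Injective J.obj := by
    have : Injective (C := CategoryTheory.Sheaf (Opens.grothendieckTopology X) (ModuleCat.{0} ℂ)) J := hJ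
    exact Injective.injective_of_adjoint
      (sheafificationAdjunction (Opens.grothendieckTopology X) (ModuleCat.{0} ℂ)) J
  exact map_surjective_of_injective J.obj h

/-- Exactness of a sequence of sheaves means local exactness on sections. -/
lemma exists_local_preimage {S : ShortComplex (TopCat.Sheaf (ModuleCat.{0} ℂ) X)} (hS : S.Exact)
    {V : Opens X} (s : Sec S.X₂ V) (hs : secMap S.g V s = 0) {x : X}
    (hx : x ∈ V) : ∃ (W : Opens X) (h : W ≤ V) (t : Sec S.X₁ W), x ∈ W ∧
      secMap S.f W t = res S.X₂ h s := by
  have h1 := (TopCat.Sheaf.exact_iff_stalkFunctor_map_exact S).1 hS x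
  rw [ShortComplex.moduleCat_exact_iff] at h1
  have e : ∀ {A B : TopCat.Sheaf (ModuleCat.{0} ℂ) X} (φ : A ⟶ B) (W : Opens X) (hW : x ∈ W)
      (t : Sec A W), ((TopCat.Sheaf.forget _ X ⋙ TopCat.Presheaf.stalkFunctor _ x).map φ).hom
        ((TopCat.Presheaf.germ A.obj W x hW).hom t) =
          (TopCat.Presheaf.germ B.obj W x hW).hom (secMap φ W t) := by
    intro A B φ W hW t
    exact TopCat.Presheaf.stalkFunctor_map_germ_apply W x hW φ.hom t
  obtain ⟨t, ht⟩ := h1 ((TopCat.Presheaf.germ S.X₂.obj V x hx).hom s) (by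
    refine (e S.g V hx s).trans ?_
    rw [hs]
    exact map_zero _)
  obtain ⟨W, hW, t, rfl⟩ := TopCat.Presheaf.exists_germ_eq S.X₁.obj t
  have h2 := (e S.f W hW t).symm.trans ht
  obtain ⟨W', hW', i, j, h3⟩ := TopCat.Presheaf.germ_eq S.X₂.obj x hW hx _ _ h2
  refine ⟨W', j.le, res S.X₁ i.le t, hW', ?_⟩
  exact (secMap_res S.f i.le t).trans h3

/-- Sections that agree locally are equal. -/
lemma sec_ext (F : TopCat.Sheaf (ModuleCat.{0} ℂ) X) {ι : Type} (U : ι → Opens X) {V : Opens X}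
    (hU : ∀ i, U i ≤ V) (hV : V ≤ ⨆ i, U i) (s t : Sec F V)
    (h : ∀ i, res F (hU i) s = res F (hU i) t) : s = t :=
  TopCat.Sheaf.eq_of_locally_eq' F U V (fun i => homOfLE (hU i)) hV s t h

/-- Sections that agree on two open sets agree on their union. -/
lemma sec_ext_pair (F : TopCat.Sheaf (ModuleCat.{0} ℂ) X) {U W V : Opens X}
    (hU : U ≤ V) (hW : W ≤ V) (hV : V ≤ U ⊔ W) (s t : Sec F V) (h : res F hU s = res F hU t)
    (h' : res F hW s = res F hW t) : s = t :=
  sec_ext F (fun b : Bool => bif b then U else W) (by rintro (_ | _) <;> assumption)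
    (hV.trans (sup_le (le_iSup (fun b : Bool => bif b then U else W) true)
      (le_iSup (fun b : Bool => bif b then U else W) false))) s t
    (by rintro (_ | _) <;> assumption)

/-- Compatible sections glue. -/
lemma exists_glue (F : TopCat.Sheaf (ModuleCat.{0} ℂ) X) {ι : Type} (U : ι → Opens X) {V : Opens X}
    (hU : ∀ i, U i ≤ V) (hV : V ≤ ⨆ i, U i) (s : ∀ i, Sec F (U i))
    (h : ∀ i j, res F (inf_le_left : U i ⊓ U j ≤ U i) (s i) =
      res F (inf_le_right : U i ⊓ U j ≤ U j) (s j)) :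
    ∃ t : Sec F V, ∀ i, res F (hU i) t = s i := by
  obtain ⟨t, ht, -⟩ := TopCat.Sheaf.existsUnique_gluing' F U V (fun i => homOfLE (hU i)) hV s h
  exact ⟨t, ht⟩

/-- Sections over two open sets that agree on the intersection glue. -/
lemma exists_glue_pair (F : TopCat.Sheaf (ModuleCat.{0} ℂ) X) {U W V : Opens X}
    (hU : U ≤ V) (hW : W ≤ V) (hV : V ≤ U ⊔ W) (s : Sec F U) (t : Sec F W)
    (h : res F (inf_le_left : U ⊓ W ≤ U) s = res F (inf_le_right : U ⊓ W ≤ W) t) :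
    ∃ r : Sec F V, res F hU r = s ∧ res F hW r = t := by
  obtain ⟨r, hr⟩ := exists_glue F (fun b : Bool => bif b then U else W) (V := V)
    (by rintro (_ | _) <;> assumption)
    (hV.trans (sup_le (le_iSup (fun b : Bool => bif b then U else W) true)
      (le_iSup (fun b : Bool => bif b then U else W) false)))
    (fun b => match b with
      | true => s
      | false => t) (by
      rintro (_ | _) (_ | _)
      · rfl
      · have := congrArg (res F (inf_comm W U).le) h
        rw [res_res, res_res] at this
        exact this.symm
      · exact h
      · rfl)
  exact ⟨r, hr true, hr false⟩

end Flasque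

/-! ### Acyclicity on basic open sets -/

section Acyclic

open PrimeSpectrum (basicOpen)

instance {X : TopCat.{0}} (V : Opens X) : Limits.PreservesFiniteLimits (sections V) := by
  have h : Limits.PreservesFiniteLimits (TopCat.Sheaf.forget (ModuleCat.{0} ℂ) X) :=
    inferInstanceAs (Limits.PreservesFiniteLimits
      (sheafToPresheaf (Opens.grothendieckTopology X) (ModuleCat.{0} ℂ)))
  have h' : Limits.PreservesFiniteLimits
      ((CategoryTheory.evaluation (Opens X)ᵒᵖ (ModuleCat.{0} ℂ)).obj (op V)) :=
    ⟨fun _ _ _ => inferInstance⟩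
  exact Limits.comp_preservesFiniteLimits (TopCat.Sheaf.forget (ModuleCat.{0} ℂ) X)
    ((CategoryTheory.evaluation (Opens X)ᵒᵖ (ModuleCat.{0} ℂ)).obj (op V))

variable {R : Type} [CommRing R]

/-- The open set of the spectrum where `f` is nonzero. -/
abbrev bas (f : R) : Opens (AlgebraicGeometry.PrimeSpectrum.Top R) := PrimeSpectrum.basicOpen f

lemma bas_mul_le_left (f g : R) : bas (f * g) ≤ bas f :=
  PrimeSpectrum.basicOpen_mul_le_left f g

lemma bas_mul (f g : R) : bas (f * g) = bas f ⊓ bas g := PrimeSpectrum.basicOpen_mul f g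

/-- For every cover of a basic open set by two basic open sets, the sections in the kernel of `φ`
on the intersection are sums of sections in the kernel on the two members of the cover. -/
def KernelDecomposes {A B : TopCat.Sheaf (ModuleCat.{0} ℂ) (AlgebraicGeometry.PrimeSpectrum.Top R)} (φ : A ⟶ B) : Prop :=
  ∀ h k f : R, bas h ≤ bas f → bas k ≤ bas f → bas f ≤ bas h ⊔ bas k →
    ∀ z : Sec A (bas h ⊓ bas k), secMap φ _ z = 0 →
      ∃ (u : Sec A (bas h)) (v : Sec A (bas k)), secMap φ _ u = 0 ∧ secMap φ _ v = 0 ∧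
        z = res A inf_le_left u + res A inf_le_right v

variable {A B C : TopCat.Sheaf (ModuleCat.{0} ℂ) (AlgebraicGeometry.PrimeSpectrum.Top R)} (φ : A ⟶ B) (ψ : B ⟶ C)

/-- The ideal of the functions `a` such that `s` lifts to `{f a ≠ 0}`. -/
def liftIdeal (hφ : KernelDecomposes φ) (f : R) (s : Sec B (bas f)) : Ideal R where
  carrier := {a | ∃ (h : bas (f * a) ≤ bas f) (t : Sec A (bas (f * a))),
    secMap φ _ t = res B h s}
  zero_mem' := by
    have h : bas (f * 0) ≤ bas f := bas_mul_le_left f 0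
    -- The open set is empty, hence covered by the empty family, so any two sections over it agree.
    refine ⟨h, 0, sec_ext B (ι := Empty) (fun i => i.elim) (fun i => i.elim) ?_ _ _
      (fun i => i.elim)⟩
    rintro p hp
    exact absurd (p.asIdeal.zero_mem) (by rwa [mul_zero] at hp)
  add_mem' {a b} := by
    rintro ⟨ha, s₁, hs₁⟩ ⟨hb, s₂, hs₂⟩
    have hc : bas (f * (a + b)) ≤ bas f := bas_mul_le_left _ _
    have h1 : bas (f * (a + b) * a) ≤ bas (f * (a + b)) := bas_mul_le_left _ _
    have h2 : bas (f * (a + b) * b) ≤ bas (f * (a + b)) := bas_mul_le_left _ _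
    have h1' : bas (f * (a + b) * a) ≤ bas (f * a) := by
      rw [show f * (a + b) * a = f * a * (a + b) by ring]
      exact bas_mul_le_left _ _
    have h2' : bas (f * (a + b) * b) ≤ bas (f * b) := by
      rw [show f * (a + b) * b = f * b * (a + b) by ring]
      exact bas_mul_le_left _ _
    -- Where `a + b` does not vanish, `a` and `b` cannot both vanish.
    have hcov : bas (f * (a + b)) ≤ bas (f * (a + b) * a) ⊔ bas (f * (a + b) * b) := by
      intro p hp
      change f * (a + b) ∉ p.asIdeal at hp
      by_cases hpa : a ∈ p.asIdeal
      · right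
        change f * (a + b) * b ∉ p.asIdeal
        intro hb
        rcases p.isPrime.mem_or_mem hb with hb | hb
        · exact hp hb
        · exact hp (Ideal.mul_mem_left _ _ (add_mem hpa hb))
      · left
        change f * (a + b) * a ∉ p.asIdeal
        intro hb
        rcases p.isPrime.mem_or_mem hb with hb | hb
        · exact hp hb
        · exact hpa hb
    -- On the overlap the two lifts differ by a section killed by `φ`. Splitting the difference and
    -- correcting each lift by its share makes them glue, without changing their images in `B`.
    obtain ⟨u, v, hu, hv, huv⟩ := hφ _ _ _ h1 h2 hcov
      (res A inf_le_left (res A h1' s₁) - res A inf_le_right (res A h2' s₂)) (by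
        rw [map_sub, secMap_res, secMap_res, secMap_res, secMap_res, hs₁, hs₂]
        simp only [res_res]
        exact sub_self _)
    obtain ⟨t, ht1, ht2⟩ := exists_glue_pair A h1 h2 hcov (res A h1' s₁ - u) (res A h2' s₂ + v) (by
      rw [map_sub, map_add, sub_eq_iff_eq_add, add_assoc, add_comm (res A _ v), ← huv]
      abel)
    refine ⟨hc, t, sec_ext_pair B h1 h2 hcov _ _ ?_ ?_⟩
    · rw [← secMap_res, ht1, map_sub, hu, sub_zero, secMap_res, hs₁, res_res, res_res]
    · rw [← secMap_res, ht2, map_add, hv, add_zero, secMap_res, hs₂, res_res, res_res]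
  smul_mem' c a := by
    rintro ⟨ha, t, ht⟩
    have h : bas (f * (c • a)) ≤ bas (f * a) := by
      rw [show f * (c • a) = f * a * c by rw [smul_eq_mul]; ring]
      exact bas_mul_le_left _ _
    exact ⟨h.trans ha, res A h t, by rw [secMap_res, ht, res_res]⟩

variable {φ ψ} in
-- Local lifts exist by exactness, so no prime containing `liftIdeal` avoids `f`. Hence a power of
-- `f` lies in this ideal, and multiplying `f` by its own power does not change the basic open set.
lemma KernelDecomposes.exists_lift (hφ : KernelDecomposes φ) {hz : φ ≫ ψ = 0}
    (hex : (ShortComplex.mk φ ψ hz).Exact) (f : R) (s : Sec B (bas f)) (hs : secMap ψ _ s = 0) :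
    ∃ t : Sec A (bas f), secMap φ _ t = s := by
  have hrad : f ∈ (liftIdeal φ hφ f s).radical := by
    rw [Ideal.radical_eq_sInf, Submodule.mem_sInf]
    rintro P ⟨hP, hPp⟩
    by_contra hf
    obtain ⟨W, hW, t, hx, ht⟩ := exists_local_preimage hex s hs (x := (⟨P, hPp⟩ : PrimeSpectrum R)) hf
    obtain ⟨_, ⟨_, ⟨a, rfl⟩, rfl⟩, haP, haW⟩ :=
      PrimeSpectrum.isBasis_basic_opens.exists_subset_of_mem_open hx W.2
    have h1 : bas (f * a) ≤ W := (PrimeSpectrum.basicOpen_mul_le_right f a).trans haW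
    exact haP (hP ⟨bas_mul_le_left f a, res A h1 t, by
      refine (secMap_res φ h1 t).trans ?_
      exact (congrArg (res B h1) ht).trans (res_res B h1 hW s)⟩)
  obtain ⟨n, h, t, ht⟩ := hrad
  have hle : bas f ≤ bas (f * f ^ n) := by
    intro p hp
    change f * f ^ n ∉ p.asIdeal
    rw [← pow_succ']
    exact fun h => hp (p.isPrime.mem_of_pow_mem _ h)
  exact ⟨res A hle t, by rw [secMap_res, ht, res_res, res_self]⟩

variable {φ ψ} in
-- Dimension shifting. A section killed by `ψ` on the overlap, itself a basic open set, lifts to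
-- `A`; by flasqueness of `A` the lift extends to one member of the cover, so the other summand can
-- be zero.
lemma KernelDecomposes.succ (hφ : KernelDecomposes φ) {hz : φ ≫ ψ = 0}
    (hex : (ShortComplex.mk φ ψ hz).Exact) (hA : Injective A) : KernelDecomposes ψ := by
  intro h k f hf kf hcov z hzz
  have hle : bas (h * k) ≤ bas h ⊓ bas k := (PrimeSpectrum.basicOpen_mul h k).le
  have hle' : bas h ⊓ bas k ≤ bas (h * k) := (PrimeSpectrum.basicOpen_mul h k).ge
  obtain ⟨t, ht⟩ := hφ.exists_lift hex (h * k) (res B hle z) (by rw [secMap_res, hzz, map_zero])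
  obtain ⟨t', ht'⟩ := res_surjective_of_injective A hA
    (bas_mul_le_left h k) t
  refine ⟨secMap φ _ t', 0, ?_, map_zero _, ?_⟩
  · rw [← secMap_comp, hz]
    rfl
  · have h1 : res B hle z = res B hle (res B inf_le_left (secMap φ _ t')) := by
      rw [← ht, ← ht', secMap_res, res_res]
    have h2 := congrArg (res B hle') h1
    rw [res_res, res_self, res_res, res_self] at h2
    rw [map_zero, add_zero, h2]

/-- For every cover of a basic open set by two basic open sets, the sections on the intersection
are sums of sections on the two members of the cover. -/
def SectionsDecompose (F : TopCat.Sheaf (ModuleCat.{0} ℂ) (AlgebraicGeometry.PrimeSpectrum.Top R)) : Prop :=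
  ∀ h k f : R, bas h ≤ bas f → bas k ≤ bas f → bas f ≤ bas h ⊔ bas k →
    ∀ z : Sec F (bas h ⊓ bas k), ∃ (u : Sec F (bas h)) (v : Sec F (bas k)),
      z = res F inf_le_left u + res F inf_le_right v

lemma exists_sec_preimage {X : TopCat.{0}} {S : ShortComplex (TopCat.Sheaf (ModuleCat.{0} ℂ) X)}
    (hS : S.Exact) (hm : Mono S.f) (V : Opens X) (s : Sec S.X₂ V) (hs : secMap S.g V s = 0) :
    ∃ t : Sec S.X₁ V, secMap S.f V t = s := by
  have h := hS.map_of_mono_of_preservesKernel (sections V) hm inferInstance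
  rw [ShortComplex.moduleCat_exact_iff] at h
  exact h s hs

/-- Start of the induction along a resolution: since taking sections is left exact, the sections
killed by `ψ` are exactly the sections of `F`. -/
lemma SectionsDecompose.kernelDecomposes {F : TopCat.Sheaf (ModuleCat.{0} ℂ) (AlgebraicGeometry.PrimeSpectrum.Top R)}
    (hF : SectionsDecompose F) {hz : φ ≫ ψ = 0} (e : F ≅ A)
    (hex : (ShortComplex.mk φ ψ hz).Exact) (hm : Mono φ) : KernelDecomposes ψ := by
  intro h k f hf kf hcov z hzz
  obtain ⟨t, ht⟩ := exists_sec_preimage hex hm _ z hzz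
  obtain ⟨u, v, huv⟩ := hF h k f hf kf hcov (secMap e.inv _ t)
  refine ⟨secMap φ _ (secMap e.hom _ u), secMap φ _ (secMap e.hom _ v), ?_, ?_, ?_⟩
  · rw [← secMap_comp, hz]; rfl
  · rw [← secMap_comp, hz]; rfl
  · have h1 := congrArg (secMap e.hom _) huv
    rw [← secMap_comp, e.inv_hom_id] at h1
    have h2 : t = secMap e.hom _ (res F inf_le_left u + res F inf_le_right v) := h1
    have h3 : secMap φ _ t = z := ht
    rw [← h3, h2, map_add, map_add, secMap_res, secMap_res, secMap_res, secMap_res]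

lemma SectionsDecompose.kernelDecomposes_d {F : TopCat.Sheaf (ModuleCat.{0} ℂ) (AlgebraicGeometry.PrimeSpectrum.Top R)}
    (hF : SectionsDecompose F) (I : InjectiveResolution F) (k : ℕ) :
    KernelDecomposes (I.cocomplex.d k (k + 1)) := by
  induction k with
  | zero =>
    have hm : Mono (I.ι.f 0) := InjectiveResolution.instMonoFNatι I 0
    exact hF.kernelDecomposes _ _ (Iso.refl _) I.exact₀ hm
  | succ k ih => exact ih.succ (I.exact_succ k) (I.injective k)

/-- A sheaf whose sections decompose has no higher cohomology on basic open sets. -/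
lemma SectionsDecompose.isZero_rightDerived {F : TopCat.Sheaf (ModuleCat.{0} ℂ) (AlgebraicGeometry.PrimeSpectrum.Top R)}
    (hF : SectionsDecompose F) (f : R) (k : ℕ) :
    Limits.IsZero (((sections (bas f)).rightDerived (k + 1)).obj F) := by
  refine Limits.IsZero.of_iso ?_
    ((injectiveResolution F).isoRightDerivedObj (sections (bas f)) (k + 1))
  refine (HomologicalComplex.exactAt_iff_isZero_homology _ _).1 ?_
  rw [HomologicalComplex.exactAt_iff' _ k (k + 1) (k + 2) (by simp) (by simp)]
  rw [ShortComplex.moduleCat_exact_iff]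
  intro s hs
  -- A cocycle in degree `k + 1` is a section killed by the next differential; lifting it through
  -- the previous one exhibits it as a coboundary.
  exact (hF.kernelDecomposes_d (injectiveResolution F) k).exists_lift
    ((injectiveResolution F).exact_succ k) f s hs

end Acyclic

/-! ### Sections vanishing on open sets -/

/-! ### Naturality of the comparison with the zeroth derived functor -/

section ToRightDerivedZero

universe v u w w'

variable {C : Type u} [Category.{v} C] [Abelian C] [HasInjectiveResolutions C]
  {D : Type w} [Category.{w'} D] [Abelian D]

lemma toRightDerivedZero'_natTrans {G G' : C ⥤ D} [G.Additive] [G'.Additive] (α : G ⟶ G') {X : C}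
    (P : InjectiveResolution X) : P.toRightDerivedZero' G ≫ HomologicalComplex.cyclesMap
      ((NatTrans.mapHomologicalComplex α (ComplexShape.up ℕ)).app P.cocomplex) 0 =
        α.app X ≫ P.toRightDerivedZero' G' := by
  rw [← cancel_mono (HomologicalComplex.iCycles _ _), Category.assoc, Category.assoc,
    HomologicalComplex.cyclesMap_i, InjectiveResolution.toRightDerivedZero'_comp_iCycles]
  rw [← Category.assoc, InjectiveResolution.toRightDerivedZero'_comp_iCycles]
  exact α.naturality _

/-- The comparison with the zeroth cohomology on the chosen injective resolution. -/
def toResHomology (G : C ⥤ D) [G.Additive] (X : C) : G.obj X ⟶ resHomology G 0 X :=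
  (injectiveResolution X).toRightDerivedZero' G ≫ (CochainComplex.isoHomologyπ₀ _).hom

lemma toResHomology_natTrans {G G' : C ⥤ D} [G.Additive] [G'.Additive] (α : G ⟶ G') (X : C) :
    toResHomology G X ≫ resNat α 0 X = α.app X ≫ toResHomology G' X := by
  have h1 := HomologicalComplex.homologyπ_naturality
    ((NatTrans.mapHomologicalComplex α (ComplexShape.up ℕ)).app (injectiveResolution X).cocomplex) 0
  have h2 := toRightDerivedZero'_natTrans α (injectiveResolution X)
  refine (Category.assoc _ _ _).trans ?_
  refine (congrArg (fun t => _ ≫ t) h1).trans ?_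
  refine (Category.assoc _ _ _).symm.trans ?_
  refine (congrArg (fun t => t ≫ _) h2).trans ?_
  exact Category.assoc _ _ _

lemma toRightDerivedZero_app_eq (G : C ⥤ D) [G.Additive] (X : C) :
    G.toRightDerivedZero.app X = toResHomology G X ≫ (resIso G 0 X).inv :=
  ((injectiveResolution X).toRightDerivedZero_eq G).trans (Category.assoc _ _ _).symm

lemma toRightDerivedZero_natTrans {G G' : C ⥤ D} [G.Additive] [G'.Additive] (α : G ⟶ G') :
    G.toRightDerivedZero ≫ NatTrans.rightDerived α 0 = α ≫ G'.toRightDerivedZero := by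
  ext X
  rw [NatTrans.comp_app, NatTrans.comp_app, toRightDerivedZero_app_eq, toRightDerivedZero_app_eq,
    rightDerived_app_eq_resNat, Category.assoc, Iso.inv_hom_id_assoc, ← Category.assoc,
    toResHomology_natTrans, Category.assoc]

/-- Isomorphic functors have isomorphic derived functors. -/
def rightDerivedIso {G G' : C ⥤ D} [G.Additive] [G'.Additive] (e : G ≅ G') (k : ℕ) :
    G.rightDerived k ≅ G'.rightDerived k where
  hom := NatTrans.rightDerived e.hom k
  inv := NatTrans.rightDerived e.inv k
  hom_inv_id := by rw [← NatTrans.rightDerived_comp, e.hom_inv_id, NatTrans.rightDerived_id]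
  inv_hom_id := by rw [← NatTrans.rightDerived_comp, e.inv_hom_id, NatTrans.rightDerived_id]

end ToRightDerivedZero

/-! ### Iterated connecting maps for sections with prescribed vanishing -/

section Vanishing

variable {X : TopCat.{0}} {ι : Type} (U : ι → Opens X)

/-- The sections over `V` that vanish on the open sets `V ∩ U i`, `i ∈ l`. -/
def vanishingSubmodule (l : List ι) (V : Opens X) (F : TopCat.Sheaf (ModuleCat.{0} ℂ) X) :
    Submodule ℂ (Sec F V) where
  carrier := {s | ∀ i ∈ l, res F (inf_le_left : V ⊓ U i ≤ V) s = 0}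
  add_mem' hs ht i hi := by rw [map_add, hs i hi, ht i hi, add_zero]
  zero_mem' i hi := map_zero _
  smul_mem' c s hs i hi := by rw [map_smul, hs i hi, smul_zero]

/-- The functor of sections over `V` that vanish on the open sets `V ∩ U i`, `i ∈ l`. -/
def vanishing (l : List ι) (V : Opens X) :
    TopCat.Sheaf (ModuleCat.{0} ℂ) X ⥤ ModuleCat.{0} ℂ where
  obj F := ModuleCat.of ℂ (vanishingSubmodule U l V F)
  map {F G} φ := ModuleCat.ofHom ((secMap φ V).restrict fun s hs i hi => by
    rw [← secMap_res, hs i hi, map_zero])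

instance (l : List ι) (V : Opens X) : (vanishing U l V).Additive where
  map_add := rfl

/-- Restriction of vanishing sections. -/
def vanishingRes (l : List ι) {V W : Opens X} (h : W ≤ V) : vanishing U l V ⟶ vanishing U l W where
  app F := ModuleCat.ofHom ((res F h).restrict fun s hs i hi => by
    have := congrArg (res F (inf_le_inf_right (U i) h)) (hs i hi)
    rw [res_res, map_zero] at this
    rw [res_res, this])
  naturality F G φ := by
    apply ModuleCat.hom_ext
    ext s
    exact Subtype.ext (secMap_res φ h s.1).symm

/-- Sections that vanish on more open sets. -/
def vanishingIncl (i : ι) (l : List ι) (V : Opens X) : vanishing U (i :: l) V ⟶ vanishing U l V where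
  app F := ModuleCat.ofHom (Submodule.inclusion fun s hs j hj => hs j (List.mem_cons_of_mem _ hj))

/-- The sequence of functors
`0 → Γ_{i :: l}(V) → Γ_l(V) → Γ_l(V ∩ U i) → 0`, exact on injective sheaves. -/
def vanishingTriple (i : ι) (l : List ι) (V : Opens X) :
    InjectiveTriple (TopCat.Sheaf (ModuleCat.{0} ℂ) X) (ModuleCat.{0} ℂ) where
  A := vanishing U (i :: l) V
  B := vanishing U l V
  E := vanishing U l (V ⊓ U i)
  α := vanishingIncl U i l V
  β := vanishingRes U l inf_le_left
  zero := by
    ext F : 2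
    apply ModuleCat.hom_ext
    ext s
    exact Subtype.ext (s.2 i List.mem_cons_self)
  exact J hJ := by
    refine ShortComplex.ShortExact.mk' ?_ ?_ ?_
    · rw [ShortComplex.moduleCat_exact_iff]
      rintro s hs
      refine ⟨⟨s.1, fun j hj => ?_⟩, rfl⟩
      rcases List.mem_cons.1 hj with rfl | hj
      · exact congrArg Subtype.val hs
      · exact s.2 j hj
    · rw [ModuleCat.mono_iff_injective]
      exact fun a b h => Subtype.ext
        (congrArg (fun t : vanishingSubmodule U l V J => t.1) h)
    · rw [ModuleCat.epi_iff_surjective]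
      rintro ⟨t, ht⟩
      -- To lift `t` so that the lift still vanishes on the `U j`, glue `t` with zero on `O` before
      -- extending to `V` by flasqueness.
      let O : Opens X := V ⊓ ⨆ j : {j // j ∈ l}, U j.1
      have hO : O ≤ V := inf_le_left
      obtain ⟨r, hr1, hr2⟩ := exists_glue_pair J (le_sup_left : V ⊓ U i ≤ (V ⊓ U i) ⊔ O) le_sup_right
        le_rfl t 0 (by
          rw [map_zero]
          refine sec_ext J (fun j : {j // j ∈ l} => (V ⊓ U i) ⊓ U j.1)
            (fun j => le_inf inf_le_left (le_inf (inf_le_left.trans inf_le_left)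
              (inf_le_right.trans (le_iSup (fun j : {j // j ∈ l} => U j.1) j)))) ?_ _ _ ?_
          · rw [← inf_iSup_eq]
            exact le_inf inf_le_left (inf_le_right.trans inf_le_right)
          · intro j
            rw [res_res, map_zero]
            exact ht j.1 j.2)
      obtain ⟨r', hr'⟩ := res_surjective_of_injective J hJ
        (sup_le inf_le_left hO : (V ⊓ U i) ⊔ O ≤ V) r
      refine ⟨⟨r', fun j hj => ?_⟩, Subtype.ext ?_⟩
      · have hle : V ⊓ U j ≤ O := le_inf inf_le_left
          (inf_le_right.trans (le_iSup (fun j : {j // j ∈ l} => U j.1) ⟨j, hj⟩))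
        have := congrArg (res J hle) hr2
        rw [← hr', res_res, res_res, map_zero] at this
        exact this
      · have := hr1
        rw [← hr', res_res] at this
        exact this

/-- Restriction to a smaller open set, as a morphism of sequences of functors. -/
def vanishingTripleRes (i : ι) (l : List ι) {V W : Opens X} (h : W ≤ V) :
    InjectiveTriple.Hom (vanishingTriple U i l V) (vanishingTriple U i l W) where
  a := vanishingRes U (i :: l) h
  b := vanishingRes U l h
  e := vanishingRes U l (inf_le_inf_right (U i) h)
  comm_left := rfl
  comm_right := by
    ext F : 2
    apply ModuleCat.hom_ext
    ext s
    exact Subtype.ext ((res_res F _ _ s.1).trans (res_res F _ _ s.1).symm)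

/-- The connecting morphism of the derived functors of vanishing sections. -/
def vanishingδ (i : ι) (l : List ι) (V : Opens X) (k : ℕ) :
    (vanishing U l (V ⊓ U i)).rightDerived k ⟶ (vanishing U (i :: l) V).rightDerived (k + 1) :=
  (vanishingTriple U i l V).δ k

lemma vanishingδ_naturality (i : ι) (l : List ι) {V W : Opens X} (h : W ≤ V) (k : ℕ) :
    NatTrans.rightDerived (vanishingRes U l (inf_le_inf_right (U i) h)) k ≫ vanishingδ U i l W k =
      vanishingδ U i l V k ≫ NatTrans.rightDerived (vanishingRes U (i :: l) h) (k + 1) :=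
  (vanishingTripleRes U i l h).δ_naturality k

/-- All sections, as sections vanishing on no open set. -/
def sectionsIso (V : Opens X) : sections V ≅ vanishing U [] V :=
  NatIso.ofComponents (fun F => LinearEquiv.toModuleIso
    { toFun := fun s => (⟨s, fun _ hi => absurd hi List.not_mem_nil⟩ : vanishingSubmodule U [] V F)
      map_add' := fun _ _ => rfl
      map_smul' := fun _ _ => rfl
      invFun := Subtype.val
      left_inv := fun _ => rfl
      right_inv := fun _ => rfl }) (fun _ => rfl)

/-- The intersection of `V` and the `U i`, `i ∈ l`. -/
def interList : List ι → Opens X → Opens X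
  | [], V => V
  | i :: l, V => interList l (V ⊓ U i)

lemma interList_mono (l : List ι) {V W : Opens X} (h : W ≤ V) :
    interList U l W ≤ interList U l V := by
  induction l generalizing V W with
  | nil => exact h
  | cons i l ih => exact ih (inf_le_inf_right _ h)

/-- The iterated connecting morphism. -/
def iteratedδ : (l : List ι) → (V : Opens X) →
    (sections (interList U l V) ⟶ (vanishing U l V).rightDerived l.length)
  | [], V => (sections V).toRightDerivedZero ≫ NatTrans.rightDerived (sectionsIso U V).hom 0
  | i :: l, V => iteratedδ l (V ⊓ U i) ≫ vanishingδ U i l V l.length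

/-- Applied to `V ⊓ U i ≤ V`, this turns the restriction map of the long exact sequence into honest
restriction of sections, which identifies the kernel of the next connecting map. -/
lemma iteratedδ_naturality (l : List ι) {V W : Opens X} (h : W ≤ V) :
    iteratedδ U l V ≫ NatTrans.rightDerived (vanishingRes U l h) l.length =
      resNatTrans (interList_mono U l h) ≫ iteratedδ U l W := by
  induction l generalizing V W with
  | nil =>
    change ((sections V).toRightDerivedZero ≫ NatTrans.rightDerived (sectionsIso U V).hom 0) ≫
      NatTrans.rightDerived (vanishingRes U [] h) 0 =
      resNatTrans h ≫ (sections W).toRightDerivedZero ≫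
        NatTrans.rightDerived (sectionsIso U W).hom 0
    rw [Category.assoc, ← NatTrans.rightDerived_comp, ← Category.assoc,
      ← toRightDerivedZero_natTrans, Category.assoc, ← NatTrans.rightDerived_comp]
    rfl
  | cons i l ih =>
    change (iteratedδ U l (V ⊓ U i) ≫ vanishingδ U i l V l.length) ≫
      NatTrans.rightDerived (vanishingRes U (i :: l) h) (l.length + 1) =
      resNatTrans (interList_mono U l (inf_le_inf_right _ h)) ≫ iteratedδ U l (W ⊓ U i) ≫
        vanishingδ U i l W l.length
    rw [Category.assoc, ← vanishingδ_naturality, ← Category.assoc, ih, Category.assoc]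

variable (F : TopCat.Sheaf (ModuleCat.{0} ℂ) X)

/-- The span of the sections that extend to one of the intersections of `V` with all but one of
the `U i`, `i ∈ l`. -/
def extendable : (l : List ι) → (V : Opens X) → Submodule ℂ (Sec F (interList U l V))
  | [], _ => ⊥
  | i :: l, V => LinearMap.range (res F (interList_mono U l (inf_le_left : V ⊓ U i ≤ V))) ⊔
      extendable l (V ⊓ U i)

variable {F}

/-- Each new open set raises the cohomological dimension by at most one: in the long exact sequence
the derived functor for `i :: l` lies between those for `l`, one of them in a degree lower by one.
The family `𝓑` keeps the induction inside open sets on which `F` is acyclic. -/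
lemma isZero_rightDerived_vanishing {𝓑 : Set (Opens X)} (h𝓑 : ∀ V ∈ 𝓑, ∀ i, V ⊓ U i ∈ 𝓑)
    (hF : ∀ V ∈ 𝓑, ∀ k, Limits.IsZero (((sections V).rightDerived (k + 1)).obj F))
    (l : List ι) {V : Opens X} (hV : V ∈ 𝓑) (k : ℕ) (hk : l.length < k) :
    Limits.IsZero (((vanishing U l V).rightDerived k).obj F) := by
  induction l generalizing V k with
  | nil =>
    obtain ⟨k, rfl⟩ : ∃ j, k = j + 1 := ⟨k - 1, by simp at hk; omega⟩
    exact (hF V hV k).of_iso ((rightDerivedIso (sectionsIso U V) (k + 1)).app F).symm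
  | cons i l ih =>
    simp only [List.length_cons] at hk
    obtain ⟨k, rfl⟩ : ∃ j, k = j + 1 := ⟨k - 1, by omega⟩
    exact ((vanishingTriple U i l V).exact_A k F).isZero_of_both_zeros
      ((ih (h𝓑 V hV i) k (by omega)).eq_of_src _ _) ((ih hV (k + 1) (by omega)).eq_of_tgt _ _)

/-- In top degree the connecting map is surjective because the derived functor for `l` vanishes one
degree above the length of `l`. Its kernel is the image of the derived functor for `l` on `V`, which
by induction is represented by sections; by naturality these contribute the restrictions from
`interList U l V`. -/
lemma iteratedδ_surjective_and_ker {𝓑 : Set (Opens X)} (h𝓑 : ∀ V ∈ 𝓑, ∀ i, V ⊓ U i ∈ 𝓑)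
    (hF : ∀ V ∈ 𝓑, ∀ k, Limits.IsZero (((sections V).rightDerived (k + 1)).obj F))
    (l : List ι) {V : Opens X} (hV : V ∈ 𝓑) :
    Function.Surjective ((iteratedδ U l V).app F).hom ∧
      LinearMap.ker ((iteratedδ U l V).app F).hom = extendable U F l V := by
  induction l generalizing V with
  | nil =>
    have h : IsIso ((iteratedδ U [] V).app F) := by
      change IsIso ((sections V).toRightDerivedZero.app F ≫
        ((rightDerivedIso (sectionsIso U V) 0).app F).hom)
      infer_instance
    have hb := (ConcreteCategory.isIso_iff_bijective _).1 h
    exact ⟨hb.2, LinearMap.ker_eq_bot.2 hb.1⟩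
  | cons i l ih =>
    obtain ⟨hs, hk⟩ := ih (h𝓑 V hV i)
    obtain ⟨hs', -⟩ := ih hV
    have hA := (vanishingTriple U i l V).exact_A l.length F
    have hE := (vanishingTriple U i l V).exact_E l.length F
    rw [ShortComplex.moduleCat_exact_iff] at hA hE
    have hz := isZero_rightDerived_vanishing U h𝓑 hF l hV (l.length + 1) (Nat.lt_succ_self _)
    constructor
    · intro y
      obtain ⟨x, hx⟩ := hA y (by
        exact ((ModuleCat.isZero_iff_subsingleton.1 hz).elim _ _))
      obtain ⟨w, hw⟩ := hs x
      refine ⟨w, ?_⟩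
      rw [← hx, ← hw]
      rfl
    · have hnat : ∀ s : Sec F (interList U l V),
          ((NatTrans.rightDerived (vanishingRes U l (inf_le_left : V ⊓ U i ≤ V)) l.length).app F).hom
            (((iteratedδ U l V).app F).hom s) = ((iteratedδ U l (V ⊓ U i)).app F).hom
              (res F (interList_mono U l inf_le_left) s) := fun s =>
        congrArg (fun t => (t.app F).hom s) (iteratedδ_naturality U l (inf_le_left : V ⊓ U i ≤ V))
      apply le_antisymm
      · intro (w : Sec F (interList U l (V ⊓ U i))) hw
        obtain ⟨b, hb⟩ := hE (((iteratedδ U l (V ⊓ U i)).app F).hom w) hw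
        obtain ⟨s, rfl⟩ := hs' b
        have h1 : ((iteratedδ U l (V ⊓ U i)).app F).hom
            (res F (interList_mono U l inf_le_left) s) =
              ((iteratedδ U l (V ⊓ U i)).app F).hom w := (hnat s).symm.trans hb
        -- After subtracting the restriction of `s`, the remainder is killed one stage earlier, so
        -- the induction hypothesis applies.
        have h2 : w - res F (interList_mono U l inf_le_left) s ∈
            LinearMap.ker ((iteratedδ U l (V ⊓ U i)).app F).hom := by
          rw [LinearMap.mem_ker, map_sub, h1, sub_self]
        rw [hk] at h2
        exact Submodule.mem_sup.2 ⟨_, ⟨s, rfl⟩, _, h2, add_sub_cancel _ _⟩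
      · refine sup_le ?_ ?_
        · rintro _ ⟨s, rfl⟩
          have h1 := congrArg (fun t => t.hom (((iteratedδ U l V).app F).hom s))
            ((vanishingTriple U i l V).comp_δ l.length F)
          refine Eq.trans ?_ h1
          exact congrArg (((vanishingTriple U i l V).δ l.length).app F).hom (hnat s).symm
        · intro w hw
          rw [← hk] at hw
          exact (congrArg (((vanishingTriple U i l V).δ l.length).app F).hom hw).trans (map_zero _)

/-- Sections supported in `Z` are the sections vanishing on a cover of the complement. -/
def supportIso (l : List ι) (Z : Closeds X) (hZ : Z.compl = ⨆ i : {i // i ∈ l}, U i.1) :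
    sectionsSupp Z ≅ vanishing U l ⊤ :=
  NatIso.ofComponents (fun F => LinearEquiv.toModuleIso
    (LinearEquiv.ofEq (LinearMap.ker (res F (le_top : Z.compl ≤ ⊤))) (vanishingSubmodule U l ⊤ F) (by
      ext s
      rw [LinearMap.mem_ker]
      constructor
      · intro hs i hi
        have hle : ⊤ ⊓ U i ≤ Z.compl := by
          rw [hZ]
          exact inf_le_right.trans (le_iSup (fun i : {i // i ∈ l} => U i.1) ⟨i, hi⟩)
        have := congrArg (res F hle) hs
        rwa [res_res, map_zero] at this
      · intro hs
        refine sec_ext F (fun i : {i // i ∈ l} => ⊤ ⊓ U i.1) (fun i => ?_) ?_ _ _ fun i => ?_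
        · rw [hZ]
          exact inf_le_right.trans (le_iSup (fun i : {i // i ∈ l} => U i.1) i)
        · simp only [top_inf_eq]
          exact hZ.le
        · rw [res_res, map_zero]
          exact hs i.1 i.2))) (fun _ => rfl)

/-- The inclusion of the sections supported in `Z`. -/
def supportIncl (Z : Closeds X) : sectionsSupp Z ⟶ sections ⊤ where
  app F := ModuleCat.ofHom (Submodule.subtype (LinearMap.ker (res F (le_top : Z.compl ≤ ⊤))))

/-- The sequence of functors `0 → Γ_Z(X) → Γ(X) → Γ(X ∖ Z) → 0`, exact on injective sheaves. -/
def supportTriple (Z : Closeds X) :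
    InjectiveTriple (TopCat.Sheaf (ModuleCat.{0} ℂ) X) (ModuleCat.{0} ℂ) where
  A := sectionsSupp Z
  B := sections ⊤
  E := sections Z.compl
  α := supportIncl Z
  β := resNatTrans le_top
  zero := by
    ext F : 2
    apply ModuleCat.hom_ext
    ext s
    exact s.2
  exact J hJ := by
    refine ShortComplex.ShortExact.mk' ?_ ?_ ?_
    · rw [ShortComplex.moduleCat_exact_iff]
      exact fun s hs => ⟨⟨s, hs⟩, rfl⟩
    · rw [ModuleCat.mono_iff_injective]
      exact fun a b h => Subtype.ext h
    · rw [ModuleCat.epi_iff_surjective]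
      exact res_surjective_of_injective J hJ le_top

/-- The connecting morphism from the cohomology of the complement to local cohomology. -/
def supportδ (Z : Closeds X) (k : ℕ) : coh Z.compl k ⟶ localCoh Z (k + 1) :=
  (supportTriple Z).δ k

/-- Both neighbouring terms are higher cohomology groups of the whole space. Starting from degree `k
+ 1` is essential: in degree zero the global sections would enter the kernel. -/
lemma supportδ_bijective (Z : Closeds X) (k : ℕ)
    (hF : ∀ j, Limits.IsZero (((sections (⊤ : Opens X)).rightDerived (j + 1)).obj F)) :
    Function.Bijective ((supportδ Z (k + 1)).app F).hom := by
  have hA := (supportTriple Z).exact_A (k + 1) F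
  have hE := (supportTriple Z).exact_E (k + 1) F
  rw [ShortComplex.moduleCat_exact_iff] at hA hE
  constructor
  · refine (injective_iff_map_eq_zero _).2 fun x hx => ?_
    obtain ⟨b, hb⟩ := hE x hx
    rw [← hb, (ModuleCat.isZero_iff_subsingleton.1 (hF k)).elim b 0]
    exact map_zero _
  · intro y
    exact hA y ((ModuleCat.isZero_iff_subsingleton.1 (hF (k + 1))).elim _ _)

end Vanishing

/-! ### Components of supermonomials -/

section Components

variable {I : Type}

/-- The variable of index `i` corresponding to a variable of the one-dimensional space. -/
def place (i : I) (v : Unit ×ₗ (ℕ ⊕ₗ ℕ)) : I ×ₗ (ℕ ⊕ₗ ℕ) := toLex (i, (ofLex v).2)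

lemma place_inj {i j : I} {u v : Unit ×ₗ (ℕ ⊕ₗ ℕ)} : place i u = place j v ↔ i = j ∧ u = v := by
  refine ⟨fun h => ?_, by rintro ⟨rfl, rfl⟩; rfl⟩
  obtain ⟨h1, h2⟩ := Prod.ext_iff.1 (toLex.injective h)
  exact ⟨h1, ofLex.injective (Prod.ext rfl h2)⟩

lemma place_injective (i : I) : Function.Injective (place i) := fun _ _ h => (place_inj.1 h).2

lemma place_ofLex (o : I ×ₗ (ℕ ⊕ₗ ℕ)) : place (ofLex o).1 (toLex ((), (ofLex o).2)) = o := rfl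

/-- The part of a supermonomial in the variables of index `i`. -/
def component (b : SuperMonomial I) (i : I) : SuperMonomial Unit :=
  (b.1.comapDomain (place i) (place_injective i).injOn,
    b.2.preimage (place i) (place_injective i).injOn)

lemma component_fst (b : SuperMonomial I) (i : I) (v) : (component b i).1 v = b.1 (place i v) := rfl

lemma mem_component_snd {b : SuperMonomial I} {i : I} {v} :
    v ∈ (component b i).2 ↔ place i v ∈ b.2 :=
  Finset.mem_preimage (hf := (place_injective i).injOn)

/-- With `exists_component`, this identifies supermonomials with families of one-index
supermonomials, matching the monomial basis with the basis of the tensor product. -/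
lemma component_ext {b b' : SuperMonomial I} (h : ∀ i, component b i = component b' i) : b = b' := by
  refine Prod.ext (Finsupp.ext fun o => ?_) (Finset.ext fun o => ?_)
  · rw [← place_ofLex o, ← component_fst, ← component_fst, h]
  · rw [← place_ofLex o, ← mem_component_snd, ← mem_component_snd, h]

lemma exists_component [Finite I] (c : I → SuperMonomial Unit) :
    ∃ b : SuperMonomial I, ∀ i, component b i = c i := by
  classical
  have := Fintype.ofFinite I
  refine ⟨(Finsupp.onFinset (Finset.univ.biUnion fun i => (c i).1.support.image (place i))
    (fun o => (c (ofLex o).1).1 (toLex ((), (ofLex o).2))) fun o ho => ?_,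
    Finset.univ.biUnion fun i => (c i).2.image (place i)), fun i => ?_⟩
  · simp only [Finset.mem_biUnion, Finset.mem_univ, true_and, Finset.mem_image]
    exact ⟨(ofLex o).1, _, Finsupp.mem_support_iff.2 ho, place_ofLex o⟩
  · refine Prod.ext (Finsupp.ext fun v => ?_) (Finset.ext fun v => ?_)
    · rw [component_fst]
      rfl
    · rw [mem_component_snd]
      simp only [Finset.mem_biUnion, Finset.mem_univ, true_and, Finset.mem_image]
      constructor
      · rintro ⟨j, u, hu, h⟩
        obtain ⟨rfl, rfl⟩ := place_inj.1 h
        exact hu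
      · exact fun hv => ⟨i, v, hv, rfl⟩

lemma component_add_single (b : SuperMonomial I) (i : I) (v) :
    component (b.1 + Finsupp.single (place i v) 1, b.2) i =
      ((component b i).1 + Finsupp.single v 1, (component b i).2) := by
  classical
  refine Prod.ext (Finsupp.ext fun u => ?_) rfl
  simp [component_fst, Finsupp.single_apply, place_inj]

lemma component_sub_single (b : SuperMonomial I) (i : I) (v) :
    component (b.1 - Finsupp.single (place i v) 1, b.2) i =
      ((component b i).1 - Finsupp.single v 1, (component b i).2) := by
  classical
  refine Prod.ext (Finsupp.ext fun u => ?_) rfl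
  simp [component_fst, Finsupp.single_apply, place_inj]

lemma component_add_single_of_ne (b : SuperMonomial I) {i j : I} (h : j ≠ i) (v) :
    component (b.1 + Finsupp.single (place i v) 1, b.2) j = component b j := by
  classical
  refine Prod.ext (Finsupp.ext fun u => ?_) rfl
  simp [component_fst, place_inj, h.symm]

lemma component_sub_single_of_ne (b : SuperMonomial I) {i j : I} (h : j ≠ i) (v) :
    component (b.1 - Finsupp.single (place i v) 1, b.2) j = component b j := by
  classical
  refine Prod.ext (Finsupp.ext fun u => ?_) rfl
  simp [component_fst, place_inj, h.symm]

variable [LinearOrder I]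

lemma component_insert (b : SuperMonomial I) (i : I) (v) :
    component (b.1, insert (place i v) b.2) i = ((component b i).1, insert v (component b i).2) := by
  refine Prod.ext rfl (Finset.ext fun u => ?_)
  simp [mem_component_snd, place_inj]

lemma component_erase (b : SuperMonomial I) (i : I) (v) :
    component (b.1, b.2.erase (place i v)) i = ((component b i).1, (component b i).2.erase v) := by
  refine Prod.ext rfl (Finset.ext fun u => ?_)
  simp [mem_component_snd, place_inj]

lemma component_insert_of_ne (b : SuperMonomial I) {i j : I} (h : j ≠ i) (v) :
    component (b.1, insert (place i v) b.2) j = component b j := by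
  refine Prod.ext rfl (Finset.ext fun u => ?_)
  simp [mem_component_snd, place_inj, h]

lemma component_erase_of_ne (b : SuperMonomial I) {i j : I} (h : j ≠ i) (v) :
    component (b.1, b.2.erase (place i v)) j = component b j := by
  refine Prod.ext rfl (Finset.ext fun u => ?_)
  simp [mem_component_snd, place_inj, h]

lemma place_lt_place {i j : I} {u v : Unit ×ₗ (ℕ ⊕ₗ ℕ)} :
    place i u < place j v ↔ i < j ∨ i = j ∧ u < v := by
  rw [place, place, Prod.Lex.toLex_lt_toLex]
  have h : u < v ↔ (ofLex u).2 < (ofLex v).2 := by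
    refine (Prod.Lex.toLex_lt_toLex (x := ofLex u) (y := ofLex v)).trans ?_
    simp
  rw [h]

/-- The sign from moving an odd variable of index `i` past the odd variables of index `j < i`. -/
def crossSign [Fintype I] (i : I) (b : SuperMonomial I) : ℤ :=
  ∏ j, if j < i then (-1) ^ (component b j).2.card else 1

/-- In the lexicographic order the odd variables preceding `place i v` are all those of smaller
index, together with the smaller ones of index `i`. The first group gives the sign rule between
tensor factors, the second the sign inside the `i`-th factor. -/
lemma oddSign_place [Fintype I] (i : I) (v) (b : SuperMonomial I) :
    oddSign (place i v) b.2 = crossSign i b * oddSign v (component b i).2 := by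
  have hcard : (b.2.filter (· < place i v)).card =
      ∑ j : I, ((if j < i then (component b j).2.card else 0) +
        if j = i then ((component b i).2.filter (· < v)).card else 0) := by
    rw [Finset.card_eq_sum_card_fiberwise (f := fun o => (ofLex o).1) (t := Finset.univ)
      (fun _ _ => Finset.mem_coe.2 (Finset.mem_univ _))]
    refine Finset.sum_congr rfl fun j _ => ?_
    have hfib : ((b.2.filter (· < place i v)).filter fun o => (ofLex o).1 = j) =
        ((component b j).2.filter fun u => place j u < place i v).map
          ⟨place j, place_injective j⟩ := by
      ext o
      simp only [Finset.mem_filter, Finset.mem_map, Function.Embedding.coeFn_mk, mem_component_snd]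
      constructor
      · rintro ⟨⟨h1, h2⟩, rfl⟩
        exact ⟨toLex ((), (ofLex o).2), ⟨h1, h2⟩, rfl⟩
      · rintro ⟨u, ⟨h1, h2⟩, rfl⟩
        exact ⟨⟨h1, h2⟩, rfl⟩
    rw [hfib, Finset.card_map]
    rcases lt_trichotomy j i with h | rfl | h
    · simp [place_lt_place, h, h.ne]
    · simp [place_lt_place]
    · simp [place_lt_place, h.ne', h.not_gt]
  rw [oddSign, hcard, Finset.sum_add_distrib, pow_add, Finset.sum_ite_eq' Finset.univ i,
    if_pos (Finset.mem_univ i), crossSign, ← Finset.prod_pow_eq_pow_sum]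
  congr 1
  refine Finset.prod_congr rfl fun j _ => ?_
  split_ifs <;> simp

end Components

/-! ### The modes on monomials -/

section Monomials

variable {I : Type}

lemma complexBasis_apply (p : I →₀ ℕ) (b : SuperMonomial I) :
    complexBasis I (p, b) = MvPolynomial.monomial p (1 : ℂ) • monomialBasis I b := by
  rw [complexBasis, Module.Basis.smulTower_apply, MvPolynomial.coe_basisMonomials]

lemma complexBasis_repr_apply (m : Dch I) (p : I →₀ ℕ) (b : SuperMonomial I) :
    (complexBasis I).repr m (p, b) = MvPolynomial.coeff p ((monomialBasis I).repr m b) := by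
  rw [complexBasis, Module.Basis.smulTower_repr]
  rfl

lemma monomial_smul_complexBasis (a p : I →₀ ℕ) (b : SuperMonomial I) :
    MvPolynomial.monomial a (1 : ℂ) • complexBasis I (p, b) = complexBasis I (a + p, b) := by
  rw [complexBasis_apply, complexBasis_apply, smul_smul, MvPolynomial.monomial_mul, one_mul]

lemma complexBasis_repr_monomial_smul (a p : I →₀ ℕ) (m : Dch I) (b : SuperMonomial I) :
    (complexBasis I).repr (MvPolynomial.monomial a (1 : ℂ) • m) (p, b) =
      if a ≤ p then (complexBasis I).repr m (p - a, b) else 0 := by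
  classical
  rw [complexBasis_repr_apply, complexBasis_repr_apply, map_smul, Finsupp.smul_apply, smul_eq_mul,
    MvPolynomial.coeff_monomial_mul', one_mul]

lemma evenMul_complexBasis (e : EvenVar I) (p : I →₀ ℕ) (b : SuperMonomial I) :
    evenMul e (complexBasis I (p, b)) = complexBasis I (p, (b.1 + Finsupp.single e 1, b.2)) := by
  rw [complexBasis_apply, complexBasis_apply, map_smul, evenMul, Module.Basis.constr_basis]

lemma evenDer_complexBasis (e : EvenVar I) (p : I →₀ ℕ) (b : SuperMonomial I) :
    evenDer e (complexBasis I (p, b)) =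
      (b.1 e : ℂ) • complexBasis I (p, (b.1 - Finsupp.single e 1, b.2)) := by
  rw [complexBasis_apply, complexBasis_apply, map_smul, evenDer, Module.Basis.constr_basis,
    Nat.cast_smul_eq_nsmul, smul_comm]

lemma pderiv_complexBasis (i : I) (p : I →₀ ℕ) (b : SuperMonomial I) :
    (Finsupp.mapRange.linearMap (MvPolynomial.pderiv (R := ℂ) i : Coord I →ₗ[ℂ] Coord I) :
      Dch I →ₗ[ℂ] Dch I) (complexBasis I (p, b)) =
        (p i : ℂ) • complexBasis I (p - Finsupp.single i 1, b) := by
  have h (a : Coord I) : a • monomialBasis I b = (Finsupp.single b a : SuperMonomial I →₀ Coord I) := by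
    change a • (Finsupp.single b 1 : SuperMonomial I →₀ Coord I) = _
    simp
  rw [complexBasis_apply, complexBasis_apply, h, h]
  change Finsupp.mapRange.linearMap _ (Finsupp.single b _ : SuperMonomial I →₀ Coord I) =
    (p i : ℂ) • (Finsupp.single b _ : SuperMonomial I →₀ Coord I)
  rw [Finsupp.mapRange.linearMap_apply, Finsupp.mapRange_single, Finsupp.smul_single]
  congr 1
  change MvPolynomial.pderiv i _ = _
  rw [MvPolynomial.pderiv_monomial, MvPolynomial.smul_monomial]
  simp

variable [LinearOrder I]

lemma oddMul_complexBasis (o : OddVar I) (p : I →₀ ℕ) (b : SuperMonomial I) :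
    oddMul o (complexBasis I (p, b)) =
      (if o ∈ b.2 then 0 else oddSign o b.2 : ℂ) • complexBasis I (p, (b.1, insert o b.2)) := by
  rw [complexBasis_apply, complexBasis_apply, map_smul, oddMul, Module.Basis.constr_basis]
  split_ifs
  · simp
  · rw [Int.cast_smul_eq_zsmul, smul_comm]

lemma oddDer_complexBasis (o : OddVar I) (p : I →₀ ℕ) (b : SuperMonomial I) :
    oddDer o (complexBasis I (p, b)) =
      (if o ∈ b.2 then oddSign o b.2 else 0 : ℂ) • complexBasis I (p, (b.1, b.2.erase o)) := by
  rw [complexBasis_apply, complexBasis_apply, map_smul, oddDer, Module.Basis.constr_basis]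
  split_ifs
  · rw [Int.cast_smul_eq_zsmul, smul_comm]
  · simp

variable [Fintype I]

/-- The operator `T` sends monomials to multiples of monomials. It acts on the variables of index
`i` as `T₁`, with the sign for passing the variables of smaller index if `ε` is odd. -/
def ActsInPlace (i : I) (ε : ℕ) (T : Dch I →ₗ[ℂ] Dch I) (T₁ : Dch Unit →ₗ[ℂ] Dch Unit) : Prop :=
  ∀ (p : I →₀ ℕ) (b : SuperMonomial I), ∃ (c : ℂ) (p' : I →₀ ℕ) (b' : SuperMonomial I),
    T (complexBasis I (p, b)) = ((crossSign i b : ℂ) ^ ε * c) • complexBasis I (p', b') ∧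
    T₁ (complexBasis Unit (Finsupp.single () (p i), component b i)) =
      c • complexBasis Unit (Finsupp.single () (p' i), component b' i) ∧
    ∀ j ≠ i, p' j = p j ∧ component b' j = component b j

lemma actsInPlace_evenMul (i : I) (v : EvenVar Unit) :
    ActsInPlace i 0 ((evenMul (place i v)).restrictScalars ℂ)
      ((evenMul v).restrictScalars ℂ) := fun p b =>
  ⟨1, p, (b.1 + Finsupp.single (place i v) 1, b.2),
    by simp [evenMul_complexBasis], by simp [evenMul_complexBasis, component_add_single],
    fun j hj => ⟨rfl, component_add_single_of_ne b hj v⟩⟩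

lemma actsInPlace_evenDer (i : I) (v : EvenVar Unit) :
    ActsInPlace i 0 ((evenDer (place i v)).restrictScalars ℂ)
      ((evenDer v).restrictScalars ℂ) := fun p b =>
  ⟨b.1 (place i v), p, (b.1 - Finsupp.single (place i v) 1, b.2),
    by simp [evenDer_complexBasis],
    by simp [evenDer_complexBasis, component_sub_single, component_fst],
    fun j hj => ⟨rfl, component_sub_single_of_ne b hj v⟩⟩

lemma actsInPlace_neg {i : I} {ε : ℕ} {T : Dch I →ₗ[ℂ] Dch I} {T₁ : Dch Unit →ₗ[ℂ] Dch Unit}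
    (h : ActsInPlace i ε T T₁) : ActsInPlace i ε (-T) (-T₁) := fun p b => by
  obtain ⟨c, p', b', h1, h2, h3⟩ := h p b
  exact ⟨-c, p', b', by simp [h1], by simp [h2], h3⟩

lemma actsInPlace_oddMul (i : I) (v : OddVar Unit) :
    ActsInPlace i 1 ((oddMul (place i v)).restrictScalars ℂ)
      ((oddMul v).restrictScalars ℂ) := fun p b => by
  refine ⟨if place i v ∈ b.2 then 0 else oddSign v (component b i).2, p,
    (b.1, insert (place i v) b.2), ?_, ?_, fun j hj => ⟨rfl, component_insert_of_ne b hj v⟩⟩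
  · rw [LinearMap.restrictScalars_apply, oddMul_complexBasis, oddSign_place]
    congr 1
    split_ifs <;> simp
  · rw [LinearMap.restrictScalars_apply, oddMul_complexBasis, component_insert]
    simp only [mem_component_snd]
    congr!

lemma actsInPlace_oddDer (i : I) (v : OddVar Unit) :
    ActsInPlace i 1 ((oddDer (place i v)).restrictScalars ℂ)
      ((oddDer v).restrictScalars ℂ) := fun p b => by
  refine ⟨if place i v ∈ b.2 then oddSign v (component b i).2 else 0, p,
    (b.1, b.2.erase (place i v)), ?_, ?_, fun j hj => ⟨rfl, component_erase_of_ne b hj v⟩⟩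
  · rw [LinearMap.restrictScalars_apply, oddDer_complexBasis, oddSign_place]
    congr 1
    split_ifs <;> simp
  · rw [LinearMap.restrictScalars_apply, oddDer_complexBasis, component_erase]
    simp only [mem_component_snd]
    congr!

/-- Multiplication by `x_{i,(-1)}` and its derivative change the exponent `p`; every other mode
changes only the supermonomial `b`. -/
lemma actsInPlace_mode (g : Gen I) (n : ℤ) :
    ActsInPlace g.index g.parity (mode g n) (mode g.one n) := by
  rcases g with i | i | i | i <;> rcases n with k | k
  · exact actsInPlace_neg (actsInPlace_evenDer i (varR () k))
  · rcases k with _ | k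
    · intro p b
      have h (J : Type) [LinearOrder J] (j : J) (p) (b) : mode (Gen.x j) (Int.negSucc 0) (complexBasis J (p, b)) =
          complexBasis J (Finsupp.single j 1 + p, b) := monomial_smul_complexBasis _ _ _
      refine ⟨1, Finsupp.single i 1 + p, b, ?_, ?_, fun j hj => ⟨?_, rfl⟩⟩
      · rw [h, Gen.parity, pow_zero, one_mul, one_smul]
      · rw [one_smul, Gen.one, h, Gen.index, Finsupp.add_apply, Finsupp.single_eq_same,
          Finsupp.single_add]
      · simp [Finsupp.single_apply, Gen.index] at hj ⊢
        exact fun h => (hj h.symm).elim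
    · exact actsInPlace_evenMul i (varL () k)
  · rcases k with _ | k
    · intro p b
      have h (J : Type) [LinearOrder J] (j : J) (p) (b) : mode (Gen.dx j) (Int.ofNat 0) (complexBasis J (p, b)) =
          (p j : ℂ) • complexBasis J (p - Finsupp.single j 1, b) := pderiv_complexBasis _ _ _
      refine ⟨p i, p - Finsupp.single i 1, b, ?_, ?_, fun j hj => ⟨?_, rfl⟩⟩
      · simp only [h, Gen.parity, pow_zero, one_mul]
      · simp only [Gen.one, h, Gen.index, Finsupp.single_eq_same, ← Finsupp.single_tsub,
          Finsupp.tsub_apply]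
      · simp [Finsupp.single_apply, Gen.index] at hj ⊢
        simp [Ne.symm hj]
    · exact actsInPlace_evenDer i (varL () k)
  · exact actsInPlace_evenMul i (varR () k)
  · exact actsInPlace_oddDer i (varR () k)
  · exact actsInPlace_oddMul i (varL () k)
  · exact actsInPlace_oddDer i (varL () k)
  · exact actsInPlace_oddMul i (varR () k)

/-- The product of the coordinates. -/
def coordProd (I : Type) [Fintype I] : Coord I := ∏ i, MvPolynomial.X i

/-- The integer `e` is one for `∂_{x_i,(0)}` and zero otherwise. The last clause records that the
correction from the quotient rule never meets a nontrivial odd sign. -/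
lemma modeDer_coordProd (g : Gen I) (n : ℤ) : ∃ e : ℕ,
    modeDer g n (coordProd I) = e • ∏ j ∈ Finset.univ.erase g.index, (MvPolynomial.X j : Coord I) ∧
    modeDer g.one n (MvPolynomial.X ()) = e • 1 ∧ (e = 0 ∨ g.parity = 0) := by
  have h0 (g : Gen I) (n) (h : modeDer g n = 0) (h' : modeDer g.one n = 0) : ∃ e : ℕ,
    modeDer g n (coordProd I) = e • ∏ j ∈ Finset.univ.erase g.index, (MvPolynomial.X j : Coord I) ∧
    modeDer g.one n (MvPolynomial.X ()) = e • 1 ∧ (e = 0 ∨ g.parity = 0) :=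
    ⟨0, by simp [h], by simp [h'], Or.inl rfl⟩
  rcases g with i | i | i | i <;> rcases n with (_ | k) | k
  case dx.ofNat.zero =>
    refine ⟨1, ?_, ?_, Or.inr rfl⟩
    · change MvPolynomial.pderiv i (∏ i, MvPolynomial.X i) = _
      rw [← Finset.mul_prod_erase _ _ (Finset.mem_univ i), Derivation.leibniz,
        MvPolynomial.pderiv_X_self]
      have : MvPolynomial.pderiv i (∏ j ∈ Finset.univ.erase i, (MvPolynomial.X j : Coord I)) = 0 := by
        refine MvPolynomial.pderiv_eq_zero_of_notMem_vars fun h => ?_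
        have := MvPolynomial.vars_prod _ h
        simp at this
      rw [this]
      simp [Gen.index]
    · change MvPolynomial.pderiv () _ = _
      rw [MvPolynomial.pderiv_X_self, one_smul]
  all_goals exact h0 _ _ rfl rfl

end Monomials

/-! ### Fractions -/

section Fractions

variable {I : Type}

/-- The linear map `m ↦ m / f ^ N`. -/
def fraction (f : Coord I) (N : ℕ) : Dch I →ₗ[ℂ] DchLoc (Submonoid.powers f) where
  toFun m := LocalizedModule.mk m (⟨f ^ N, N, rfl⟩ : Submonoid.powers f)
  map_add' m m' := by
    rw [LocalizedModule.mk_add_mk, ← smul_add, LocalizedModule.mk_cancel_common_left]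
  map_smul' c m := (smul_mk _ c m _).symm

lemma exists_fraction (f : Coord I) (y : DchLoc (Submonoid.powers f)) :
    ∃ N m, fraction f N m = y := by
  induction y using LocalizedModule.induction_on with | _ m s
  obtain ⟨_, N, rfl⟩ := s
  exact ⟨N, m, rfl⟩

lemma fraction_pow_smul (f : Coord I) (N k : ℕ) (m : Dch I) :
    fraction f (N + k) (f ^ k • m) = fraction f N m := by
  refine LocalizedModule.mk_eq.2 ⟨1, ?_⟩
  simp only [Submonoid.smul_def, one_smul, smul_smul, pow_add]

lemma exists_fraction_pair (f : Coord I) (y z : DchLoc (Submonoid.powers f)) :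
    ∃ N m m', fraction f N m = y ∧ fraction f N m' = z := by
  obtain ⟨N, m, rfl⟩ := exists_fraction f y
  obtain ⟨N', m', rfl⟩ := exists_fraction f z
  exact ⟨N + N', f ^ N' • m, f ^ N • m', fraction_pow_smul f N N' m, by
    rw [add_comm, fraction_pow_smul]⟩

lemma fraction_eq_fraction {f : Coord I} {N N' : ℕ} {m m' : Dch I}
    (h : fraction f N m = fraction f N' m') :
    ∃ u : ℕ, f ^ (u + N') • m = f ^ (u + N) • m' := by
  obtain ⟨⟨_, u, rfl⟩, hu⟩ := LocalizedModule.mk_eq.1 h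
  simp only [Submonoid.smul_def, smul_smul, ← pow_add] at hu
  exact ⟨u, hu⟩

/-- For a denominator `f ^ N` the quotient rule simplifies: the derivative of the denominator
contains `f ^ (N - 1)`, which cancels and leaves a pole of order `N + 1`. -/
lemma locMode_mk_pow [LinearOrder I] (g : Gen I) (n : ℤ) (f : Coord I) (m : Dch I) (N : ℕ)
    (s t : Submonoid.powers f) (hs : (s : Coord I) = f ^ N) (ht : (t : Coord I) = f ^ (N + 1)) :
    locMode (Submonoid.powers f) g n (LocalizedModule.mk m s) =
      LocalizedModule.mk (mode g n m) s -
        (N : ℂ) • LocalizedModule.mk (modeDer g n f • m) t := by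
  rw [locMode_mk, smul_mk, sub_eq_add_neg (LocalizedModule.mk _ _),
    ← LocalizedModule.mk_neg, LocalizedModule.mk_add_mk]
  refine LocalizedModule.mk_eq.2 ⟨1, ?_⟩
  simp only [Submonoid.smul_def, Submonoid.coe_mul, one_smul, hs, ht, Derivation.leibniz_pow,
    Nat.cast_smul_eq_nsmul]
  rcases N with _ | N
  · simp [smul_smul]
  · simp only [Nat.add_sub_cancel, smul_eq_mul]
    module

lemma locMode_fraction [LinearOrder I] (g : Gen I) (n : ℤ) (f : Coord I) (m : Dch I) (N : ℕ) :
    locMode (Submonoid.powers f) g n (fraction f N m) =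
      fraction f N (mode g n m) - (N : ℂ) • fraction f (N + 1) (modeDer g n f • m) :=
  locMode_mk_pow g n f m N _ _ rfl rfl

end Fractions

/-! ### The one-dimensional quotient -/

section Quotient

open MvPolynomial in
/-- The class of `x_{(-1)} ^ k c / x_{(-1)} ^ N`. -/
def dualClass (N k : ℕ) (c : SuperMonomial Unit) : DchOneQuot :=
  dchOneRange.mkQ (fraction (X ()) N (complexBasis Unit (Finsupp.single () k, c)))

lemma X_pow_smul_complexBasis {I : Type} (i : I) (k : ℕ) (p : I →₀ ℕ) (b : SuperMonomial I) :
    (MvPolynomial.X i ^ k : Coord I) • complexBasis I (p, b) =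
      complexBasis I (Finsupp.single i k + p, b) := by
  rw [MvPolynomial.X_pow_eq_monomial, monomial_smul_complexBasis]

lemma dualClass_add (N k l : ℕ) (c : SuperMonomial Unit) :
    dualClass (N + l) (k + l) c = dualClass N k c := by
  rw [dualClass, dualClass, ← fraction_pow_smul _ N l, X_pow_smul_complexBasis,
    ← Finsupp.single_add, add_comm l k]

lemma mkQ_fraction_zero (m : Dch Unit) :
    dchOneRange.mkQ (fraction (MvPolynomial.X ()) 0 m) = 0 := by
  rw [Submodule.mkQ_apply, Submodule.Quotient.mk_eq_zero]
  refine ⟨m, ?_⟩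
  change LocalizedModule.mk m 1 = LocalizedModule.mk m _
  congr 1

lemma dualClass_eq_zero {N k : ℕ} (h : N ≤ k) (c : SuperMonomial Unit) : dualClass N k c = 0 := by
  obtain ⟨l, rfl⟩ := Nat.exists_eq_add_of_le' h
  rw [← Nat.zero_add N, add_comm l, ← add_comm l, ← add_assoc, add_zero, dualClass_add, dualClass,
    mkQ_fraction_zero]

/-- If `m / x^N` is regular, then `x^u m` is divisible by `x^(u + N)` for some `u`. Comparing
coefficients at exponent `u + k` gives the vanishing. -/
lemma repr_eq_zero_of_mkQ_fraction {N : ℕ} {m : Dch Unit}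
    (h : dchOneRange.mkQ (fraction (MvPolynomial.X ()) N m) = 0) (k : ℕ) (hk : k < N)
    (c : SuperMonomial Unit) : (complexBasis Unit).repr m (Finsupp.single () k, c) = 0 := by
  rw [Submodule.mkQ_apply, Submodule.Quotient.mk_eq_zero] at h
  obtain ⟨m', hm'⟩ := h
  have h : fraction (MvPolynomial.X ()) 0 m' = fraction (MvPolynomial.X ()) N m := by
    rw [← hm']
    change LocalizedModule.mk m' _ = LocalizedModule.mk m' 1
    congr 1
  obtain ⟨u, hu⟩ := fraction_eq_fraction h
  have := congrArg (fun m => (complexBasis Unit).repr m (Finsupp.single () (u + k), c)) hu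
  simp only [MvPolynomial.X_pow_eq_monomial, complexBasis_repr_monomial_smul,
    Finsupp.single_le_single, ← Finsupp.single_tsub] at this
  rw [if_neg (by omega), if_pos (by omega)] at this
  rw [this]
  congr 3
  omega

lemma linearIndependent_dualClass :
    LinearIndependent ℂ fun x : ℕ × SuperMonomial Unit => dualClass (x.1 + 1) 0 x.2 := by
  refine linearIndependent_iff'.2 fun s a h x hx => ?_
  -- The power `K + 1` is a common denominator for the finitely many classes in the relation.
  obtain ⟨K, hK⟩ := (s.image Prod.fst).exists_le
  have hle {y : ℕ × SuperMonomial Unit} (hy : y ∈ s) : y.1 ≤ K := hK _ (Finset.mem_image_of_mem _ hy)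
  have h1 : ∀ y ∈ s, a y • dualClass (y.1 + 1) 0 y.2 =
      dchOneRange.mkQ (fraction (MvPolynomial.X ()) (K + 1)
        (a y • complexBasis Unit (Finsupp.single () (K - y.1), y.2))) := fun y hy => by
    rw [← dualClass_add _ _ (K - y.1), map_smul, map_smul, dualClass]
    congr 4
    · have := hle hy
      omega
    · rw [zero_add]
  rw [Finset.sum_congr rfl h1, ← map_sum, ← map_sum] at h
  have h2 := repr_eq_zero_of_mkQ_fraction h (K - x.1) (by omega) x.2
  rw [map_sum, Finsupp.finsetSum_apply, Finset.sum_eq_single x] at h2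
  · simpa using h2
  · intro y hy hne
    rw [map_smul, Module.Basis.repr_self, Finsupp.smul_apply, Finsupp.single_eq_of_ne, smul_zero]
    intro heq
    refine hne ?_
    replace heq := heq.symm
    simp only [Prod.mk.injEq] at heq
    have h3 := Finsupp.single_injective () heq.1
    have := hle hy
    have := hle hx
    exact Prod.ext (by omega) heq.2
  · exact fun h => (h hx).elim

lemma span_dualClass :
    ⊤ ≤ Submodule.span ℂ (Set.range fun x : ℕ × SuperMonomial Unit => dualClass (x.1 + 1) 0 x.2) := by
  rintro q -
  obtain ⟨y, rfl⟩ := Submodule.mkQ_surjective _ q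
  obtain ⟨N, m, rfl⟩ := exists_fraction _ y
  induction (complexBasis Unit).mem_span m using Submodule.span_induction with
  | mem x h =>
    obtain ⟨⟨p, c⟩, rfl⟩ := h
    obtain ⟨k, rfl⟩ : ∃ k, p = Finsupp.single () k := ⟨p (), by ext; simp⟩
    change dualClass N k c ∈ _
    rcases le_or_gt N k with h | h
    · rw [dualClass_eq_zero h]
      exact zero_mem _
    · obtain ⟨l, rfl⟩ := Nat.exists_eq_add_of_lt h
      refine Submodule.subset_span ⟨(l, c), ?_⟩
      change dualClass (l + 1) 0 c = _
      rw [← dualClass_add _ _ k]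
      congr 1 <;> omega
  | zero => simp
  | add u v _ _ hu hv =>
    rw [map_add, map_add]
    exact add_mem hu hv
  | smul a x _ hx =>
    rw [map_smul, map_smul]
    exact Submodule.smul_mem _ _ hx

/-- The basis of the quotient given by the classes of `c / x_{(-1)} ^ (k + 1)`. -/
def dualBasis : Module.Basis (ℕ × SuperMonomial Unit) ℂ DchOneQuot :=
  Module.Basis.mk linearIndependent_dualClass span_dualClass

lemma dualBasis_apply (k : ℕ) (c : SuperMonomial Unit) : dualBasis (k, c) = dualClass (k + 1) 0 c := by
  simp [dualBasis]

lemma dualClass_of_lt {N k : ℕ} (h : k < N) (c : SuperMonomial Unit) :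
    dualClass N k c = dualBasis (N - k - 1, c) := by
  rw [dualBasis_apply, ← dualClass_add _ 0 k]
  congr 1 <;> omega

lemma dualBasis_repr_dualClass [DecidableEq (SuperMonomial Unit)] {N k l : ℕ} (hl : l < N) (c d : SuperMonomial Unit) :
    dualBasis.repr (dualClass N k c) (N - l - 1, d) = if k = l ∧ c = d then 1 else 0 := by
  rcases le_or_gt N k with h | h
  · rw [dualClass_eq_zero h, map_zero, if_neg (by omega)]
    rfl
  · rw [dualClass_of_lt h, Module.Basis.repr_self, Finsupp.single_apply]
    congr 1
    simp only [Prod.mk.injEq, eq_iff_iff]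
    refine and_congr_left fun _ => ?_
    omega

lemma quotMode_dualClass (g : Gen Unit) (n : ℤ) (N k : ℕ) (c : SuperMonomial Unit) {e : ℕ}
    (he : modeDer g n (MvPolynomial.X ()) = e • 1) :
    quotMode g n (dualClass N k c) =
      dchOneRange.mkQ (fraction (MvPolynomial.X ()) N
        (mode g n (complexBasis Unit (Finsupp.single () k, c)))) -
      (N * e : ℂ) • dualClass (N + 1) k c := by
  change dchOneRange.mkQ (locMode _ g n (fraction (MvPolynomial.X ()) N _)) = _
  rw [locMode_fraction, he, map_sub, map_smul, dualClass]
  congr 1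
  rw [mul_smul, smul_assoc, one_smul, map_nsmul, map_nsmul, Nat.cast_smul_eq_nsmul ℂ e]

lemma quotParity_dualClass (N k : ℕ) (c : SuperMonomial Unit) :
    quotParity (dualClass N k c) = ((-1) ^ c.2.card : ℂ) • dualClass N k c := by
  rw [dualClass, ← map_smul, ← map_smul]
  change dchOneRange.mkQ (LocalizedModule.mk _ _) = dchOneRange.mkQ (LocalizedModule.mk _ _)
  congr 1
  refine LocalizedModule.mk_eq.2 ⟨1, ?_⟩
  simp only [Submonoid.smul_def, one_smul, Submonoid.coe_mul]
  have : parityOp Unit (complexBasis Unit (Finsupp.single () k, c)) =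
      ((-1) ^ c.2.card : ℂ) • complexBasis Unit (Finsupp.single () k, c) := by
    rw [complexBasis_apply, map_smul, parityOp, Module.Basis.constr_basis, smul_comm]
    rw [← Int.cast_smul_eq_zsmul ℂ]
    simp
  simp only [LinearMap.restrictScalars_apply, this]
  simp [smul_smul]

end Quotient

/-! ### The map to the vertex dual -/

section ToDual

variable {I : Type} [Fintype I]

lemma coordProd_pow_smul_complexBasis (k : ℕ) (p : I →₀ ℕ) (b : SuperMonomial I) :
    coordProd I ^ k • complexBasis I (p, b) =
      complexBasis I (Finsupp.equivFunOnFinite.symm (fun _ => k) + p, b) := by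
  rw [← monomial_smul_complexBasis, coordProd, ← Finset.prod_pow, MvPolynomial.monomial_eq]
  simp [Finsupp.prod_fintype]

lemma prod_erase_smul_complexBasis [DecidableEq I] (i : I) (p : I →₀ ℕ) (b : SuperMonomial I) :
    (∏ j ∈ Finset.univ.erase i, (MvPolynomial.X j : Coord I)) • complexBasis I (p, b) =
      complexBasis I (Finsupp.equivFunOnFinite.symm (fun j => if j = i then 0 else 1) + p, b) := by
  rw [← monomial_smul_complexBasis, MvPolynomial.monomial_eq, Finsupp.prod_fintype _ _ (by simp),
    ← Finset.mul_prod_erase Finset.univ _ (Finset.mem_univ i)]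
  simp only [Finsupp.equivFunOnFinite_symm_apply_apply, if_true, pow_zero, one_mul, map_one]
  congr 1
  refine Finset.prod_congr rfl fun j hj => ?_
  rw [if_neg (Finset.ne_of_mem_erase hj), pow_one]

/-- The linear map sending the monomial `m = ∏ x_i ^ p i * b` to the class of
`⨂ x_i ^ (p i - N) * b_i`, where `b_i` is the part of `b` of index `i`. -/
def toDualAux (I : Type) [Fintype I] (N : ℕ) : Dch I →ₗ[ℂ] VertexDual I :=
  (complexBasis I).constr ℂ fun x =>
    PiTensorProduct.tprod ℂ fun i => dualClass N (x.1 i) (component x.2 i)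

lemma toDualAux_complexBasis (N : ℕ) (p : I →₀ ℕ) (b : SuperMonomial I) :
    toDualAux I N (complexBasis I (p, b)) =
      PiTensorProduct.tprod ℂ fun i => dualClass N (p i) (component b i) := by
  rw [toDualAux, Module.Basis.constr_basis]

lemma toDualAux_pow_smul (N k : ℕ) (m : Dch I) :
    toDualAux I (N + k) (coordProd I ^ k • m) = toDualAux I N m := by
  induction (complexBasis I).mem_span m using Submodule.span_induction with
  | mem x h =>
    obtain ⟨⟨p, b⟩, rfl⟩ := h
    rw [coordProd_pow_smul_complexBasis, toDualAux_complexBasis, toDualAux_complexBasis]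
    congr 1
    ext i
    rw [Finsupp.add_apply, Finsupp.equivFunOnFinite_symm_apply_apply, add_comm k, dualClass_add]
  | zero => simp
  | add u v _ _ hu hv => rw [smul_add, map_add, map_add, hu, hv]
  | smul a x _ hx => rw [smul_comm _ a x, map_smul _ a, map_smul _ a, hx]

lemma toDualAux_eq {N N' u : ℕ} {m m' : Dch I}
    (h : coordProd I ^ (u + N') • m = coordProd I ^ (u + N) • m') :
    toDualAux I N m = toDualAux I N' m' := by
  rw [← toDualAux_pow_smul N (u + N'), h, ← toDualAux_pow_smul N' (u + N), add_left_comm,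
    add_left_comm N', add_comm N]

/-- The map `D^ch[x_i⁻¹, i ∈ I] → (D^ch)^d`. -/
def toDual (I : Type) [Fintype I] : DchLoc (Submonoid.powers (coordProd I)) →ₗ[ℂ] VertexDual I :=
  -- The value is defined through a chosen representation as a fraction; `key` shows that any other
  -- representation gives the same value.
  have key (N : ℕ) (m : Dch I) (y : DchLoc (Submonoid.powers (coordProd I)))
      (h : fraction _ N m = y) :
      toDualAux I (exists_fraction _ y).choose (exists_fraction _ y).choose_spec.choose =
        toDualAux I N m := by
    obtain ⟨u, hu⟩ := fraction_eq_fraction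
      ((exists_fraction _ y).choose_spec.choose_spec.trans h.symm)
    exact toDualAux_eq hu
  { toFun y := toDualAux I (exists_fraction _ y).choose (exists_fraction _ y).choose_spec.choose
    map_add' y z := by
      obtain ⟨N, m, m', hy, hz⟩ := exists_fraction_pair _ y z
      rw [key N m y hy, key N m' z hz, key N (m + m') (y + z) (by rw [map_add, hy, hz]), map_add]
    map_smul' c y := by
      obtain ⟨N, m, hy⟩ := exists_fraction _ y
      rw [key N m y hy, key N (c • m) (c • y) (by rw [map_smul, hy]), map_smul, RingHom.id_apply] }

lemma toDual_fraction (N : ℕ) (m : Dch I) : toDual I (fraction _ N m) = toDualAux I N m := by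
  obtain ⟨u, hu⟩ := fraction_eq_fraction
    (exists_fraction _ (fraction (coordProd I) N m)).choose_spec.choose_spec
  exact toDualAux_eq hu

lemma toDual_surjective : Function.Surjective (toDual I) := by
  rw [← LinearMap.range_eq_top, eq_top_iff,
    ← (Basis.piTensorProduct fun _ : I => dualBasis).span_eq, Submodule.span_le]
  rintro _ ⟨κ, rfl⟩
  obtain ⟨b, hb⟩ := exists_component fun i => (κ i).2
  -- With common denominator exponent `K + 1`, a numerator exponent `K - k` leaves a pole of order
  -- `k + 1`, the one carried by the basis vector of index `k`.
  obtain ⟨K, hK⟩ := (Finset.univ.image fun i => (κ i).1).exists_le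
  have hle (i : I) : (κ i).1 ≤ K := hK _ (Finset.mem_image_of_mem _ (Finset.mem_univ i))
  refine ⟨fraction _ (K + 1) (complexBasis I
    (Finsupp.equivFunOnFinite.symm fun i => K - (κ i).1, b)), ?_⟩
  rw [toDual_fraction, toDualAux_complexBasis, Basis.piTensorProduct_apply]
  congr 1
  ext i
  have := hle i
  rw [Finsupp.equivFunOnFinite_symm_apply_apply, dualClass_of_lt (by omega), hb]
  congr 2
  omega

/-- The coefficients of monomials with all exponents below `N` can be read off from the image, so
elements of the kernel involve only monomials with some exponent at least `N`. The index `N - p i -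
1` is the pole order minus one. -/
lemma toDualAux_repr (N : ℕ) (m : Dch I) (p : I →₀ ℕ) (hp : ∀ i, p i < N) (b : SuperMonomial I) :
    (Basis.piTensorProduct fun _ : I => dualBasis).repr (toDualAux I N m)
      (fun i => (N - p i - 1, component b i)) = (complexBasis I).repr m (p, b) := by
  classical
  induction (complexBasis I).mem_span m using Submodule.span_induction with
  | mem x h =>
    obtain ⟨⟨p', b'⟩, rfl⟩ := h
    rw [toDualAux_complexBasis, Basis.piTensorProduct_repr_tprod_apply, Module.Basis.repr_self,
      Finsupp.single_apply, Finset.prod_congr rfl fun i _ => dualBasis_repr_dualClass (hp i) _ _,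
      Finset.prod_boole]
    congr 1
    simp only [Finset.mem_univ, true_imp_iff, Prod.mk.injEq, eq_iff_iff, forall_and]
    refine and_congr Finsupp.ext_iff.symm ⟨component_ext, ?_⟩
    rintro rfl
    exact fun _ => rfl
  | zero => simp
  | add u v _ _ hu hv =>
    simp only [map_add, Finsupp.add_apply, hu, hv]
  | smul a x _ hx => simp only [map_smul, Finsupp.smul_apply, hx]

lemma fraction_mem_of_toDual_eq_zero {N : ℕ} {m : Dch I}
    (h : toDual I (fraction _ N m) = 0) (K : Submodule ℂ (DchLoc (Submonoid.powers (coordProd I))))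
    (hK : ∀ (p : I →₀ ℕ) (b : SuperMonomial I) (i : I), N ≤ p i →
      fraction _ N (complexBasis I (p, b)) ∈ K) : fraction _ N m ∈ K := by
  rw [toDual_fraction] at h
  rw [← (complexBasis I).linearCombination_repr m, Finsupp.linearCombination_apply, Finsupp.sum,
    map_sum]
  refine Submodule.sum_mem _ fun ⟨p, b⟩ hx => ?_
  obtain ⟨i, hi⟩ : ∃ i, N ≤ p i := by
    by_contra! hp
    refine Finsupp.mem_support_iff.1 hx ?_
    rw [← toDualAux_repr N m p hp b, h, map_zero]
    rfl
  rw [map_smul]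
  exact K.smul_mem _ (hK p b i hi)

lemma toDual_fraction_X_pow_smul (N : ℕ) (i : I) (m : Dch I) :
    toDual I (fraction _ N ((MvPolynomial.X i : Coord I) ^ N • m)) = 0 := by
  rw [toDual_fraction]
  induction (complexBasis I).mem_span m using Submodule.span_induction with
  | mem x h =>
    obtain ⟨⟨p, b⟩, rfl⟩ := h
    rw [X_pow_smul_complexBasis, toDualAux_complexBasis]
    refine (PiTensorProduct.tprod ℂ).map_coord_zero i (dualClass_eq_zero ?_ _)
    simp
  | zero => simp
  | add u v _ _ hu hv => rw [smul_add, map_add, hu, hv, add_zero]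
  | smul a x _ hx => rw [smul_comm, map_smul, hx, smul_zero]

variable [LinearOrder I]

lemma dualMode_tprod (g : Gen I) (n : ℤ) (N : ℕ) (p : I →₀ ℕ) (b : SuperMonomial I) :
    dualMode g n (PiTensorProduct.tprod ℂ fun i => dualClass N (p i) (component b i)) =
      (crossSign g.index b : ℂ) ^ g.parity • PiTensorProduct.tprod ℂ
        (Function.update (fun i => dualClass N (p i) (component b i)) g.index
          (quotMode g.one n (dualClass N (p g.index) (component b g.index)))) := by
  have hpar (j : I) : (quotParity ^ g.parity) (dualClass N (p j) (component b j)) =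
      ((-1) ^ (component b j).2.card : ℂ) ^ g.parity • dualClass N (p j) (component b j) := by
    have : g.parity = 0 ∨ g.parity = 1 := by cases g <;> simp [Gen.parity]
    rcases this with h | h <;> simp [h, quotParity_dualClass]
  rw [dualMode, PiTensorProduct.map_tprod, crossSign, Int.cast_prod, ← Finset.prod_pow,
    ← MultilinearMap.map_smul_univ]
  congr 1
  ext j
  by_cases hj : j = g.index
  · subst hj
    simp
  · rw [if_neg hj, Function.update_of_ne hj]
    split_ifs with h
    · rw [hpar]
      push_cast
      rfl
    · simp

/-- Checked on monomials, with the two terms of the quotient rule treated separately. In the second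
term the missing factor of the product of coordinates raises the pole order at index `g.index` only,
since the other coordinates cancel. -/
lemma toDual_locMode (g : Gen I) (n : ℤ) (y : DchLoc (Submonoid.powers (coordProd I))) :
    toDual I (locMode _ g n y) = dualMode g n (toDual I y) := by
  obtain ⟨N, m, rfl⟩ := exists_fraction _ y
  induction (complexBasis I).mem_span m using Submodule.span_induction with
  | mem x h =>
    obtain ⟨⟨p, b⟩, rfl⟩ := h
    obtain ⟨e, he, he1, he0⟩ := modeDer_coordProd g n
    have hneg (c : ℂ) (v : VertexDual I) : (-c) • v = -(c • v) := neg_smul c v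
    have hsub (s : ℂ) (v w : VertexDual I) : s • (v + -w) = s • v - s • w := by
      rw [← sub_eq_add_neg]
      exact smul_sub s v w
    obtain ⟨c, p', b', h1, h2, h3⟩ := actsInPlace_mode g n p b
    rw [locMode_fraction, map_sub, map_smul, toDual_fraction, toDual_fraction, toDual_fraction,
      h1, he, smul_assoc, map_nsmul, map_smul, prod_erase_smul_complexBasis]
    simp only [toDualAux_complexBasis]
    rw [dualMode_tprod, quotMode_dualClass _ _ _ _ _ he1, h2, map_smul, map_smul,
      sub_eq_add_neg (c • _), ← neg_smul, MultilinearMap.map_update_add,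
      MultilinearMap.map_update_smul, MultilinearMap.map_update_smul, hneg, hsub,
      smul_smul, smul_smul]
    congr 1
    · congr 2
      ext j
      by_cases hj : j = g.index
      · subst hj
        simp [dualClass]
      · rw [Function.update_of_ne hj, (h3 j hj).1, (h3 j hj).2]
    · rw [← Nat.cast_smul_eq_nsmul ℂ, smul_smul]
      congr 1
      -- The sign is trivial unless `e = 0`, in which case both coefficients vanish.
      · rcases he0 with h | h <;> simp [h]
      · congr 1
        ext j
        by_cases hj : j = g.index
        · subst hj
          simp
        · rw [Function.update_of_ne hj]
          simp [hj, add_comm 1, dualClass_add]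
  | zero => simp
  | add u v _ _ hu hv => simp only [map_add, hu, hv]
  | smul a x _ hx => simp only [map_smul, hx]

lemma toDual_act (a : Dch I) (n : ℤ) (y : DchLoc (Submonoid.powers (coordProd I))) :
    toDual I (act (locField _) a n y) = dualAct a n (toDual I y) :=
  act_comm (locField _) dualField (toDual I) (fun g n y => by
    rw [locField, ncoeff_ofModes, dualField, ncoeff_ofModes, toDual_locMode]) a n y

end ToDual

/-! ### Sections of the sheaf over basic open sets -/

section SheafSections

variable {I : Type}

/-- The section `m / g` over an open set on which `g` is invertible. -/
def constSec (m : Dch I) (g : Coord I) (V : Opens (Aff I)) (hV : V ≤ bas g) : Sec (DchSheaf I) V :=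
  (⟨fun p => LocalizedModule.mk m ⟨g, hV p.2⟩,
    fun p => ⟨V, p.2, 𝟙 _, m, g, fun q => ⟨hV q.2, rfl⟩⟩⟩ : DchSections V)

lemma dchSec_ext {V : Opens (Aff I)} {s t : DchSections V} (h : ∀ p, s.1 p = t.1 p) : s = t :=
  Subtype.ext (funext h)

lemma res_constSec (m : Dch I) (g : Coord I) {V W : Opens (Aff I)} (hV : V ≤ bas g) (h : W ≤ V) :
    res (DchSheaf I) h (constSec m g V hV) = constSec m g W (h.trans hV) := rfl

lemma bas_le_bas_pow (f : Coord I) (N : ℕ) : bas f ≤ bas (f ^ N) := fun _ hp =>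
  pow_mem (S := primeCompl _) hp N

/-- Sections over a basic open set form the localized module, so some `f ^ N • s` comes from a
global element; dividing by `f ^ N` is then checked in each stalk. -/
lemma exists_constSec (f : Coord I) (s : Sec (DchSheaf I) (bas f)) :
    ∃ (N : ℕ) (m : Dch I), s = constSec m (f ^ N) (bas f) (bas_le_bas_pow f N) := by
  obtain ⟨⟨m, ⟨_, N, rfl⟩⟩, h⟩ := IsLocalizedModule.surj (Submonoid.powers f)
    (AlgebraicGeometry.StructureSheaf.toOpenₗ (Coord I) (Dch I) (bas f)) s
  refine ⟨N, m, dchSec_ext fun p => ?_⟩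
  have hp : f ^ N • s.1 p = (LocalizedModule.mk m 1 : DchLoc (primeCompl p.1)) :=
    congrFun (congrArg Subtype.val h) p
  change (s.1 p : DchLoc (primeCompl p.1)) = LocalizedModule.mk m ⟨f ^ N, bas_le_bas_pow f N p.2⟩
  generalize (s.1 p : DchLoc (primeCompl p.1)) = y at hp ⊢
  induction y using LocalizedModule.induction_on with | _ m' s'
  rw [LocalizedModule.smul'_mk] at hp
  obtain ⟨u, hu⟩ := LocalizedModule.mk_eq.1 hp
  refine LocalizedModule.mk_eq.2 ⟨u, ?_⟩
  simpa [Submonoid.smul_def] using hu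

lemma exists_pow_smul_eq_zero {f : Coord I} {N : ℕ} {m : Dch I}
    (h : constSec m (f ^ N) (bas f) (bas_le_bas_pow f N) = 0) : ∃ u : ℕ, f ^ u • m = 0 := by
  obtain ⟨⟨_, u, rfl⟩, hu⟩ := IsLocalizedModule.exists_of_eq (S := Submonoid.powers f)
    (f := AlgebraicGeometry.StructureSheaf.toOpenₗ (Coord I) (Dch I) (bas f))
    (x₁ := m) (x₂ := 0) (by
      rw [map_zero]
      refine dchSec_ext fun p => ?_
      have hp : (LocalizedModule.mk m ⟨f ^ N, bas_le_bas_pow f N p.2⟩ :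
          DchLoc (primeCompl p.1)) = 0 := congrFun (congrArg Subtype.val h) p
      change (LocalizedModule.mk m 1 : DchLoc (primeCompl p.1)) = 0
      rw [← LocalizedModule.zero_mk 1, LocalizedModule.mk_eq] at hp ⊢
      obtain ⟨u, hu⟩ := hp
      refine ⟨u, ?_⟩
      simpa [Submonoid.smul_def] using hu)
  exact ⟨u, by simpa [Submonoid.smul_def] using hu⟩

lemma exists_pow_eq_of_bas_le {f h k : Coord I} (hf : bas f ≤ bas h ⊔ bas k) (N : ℕ) :
    ∃ (L : ℕ) (a b : Coord I), a * h ^ N + b * k ^ N = f ^ L := by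
  have hrad : f ∈ (Ideal.span {h ^ N, k ^ N}).radical := by
    rw [Ideal.radical_eq_sInf, Submodule.mem_sInf]
    rintro P ⟨hP, hprime⟩
    by_contra hfP
    have hle : h ^ N ∈ P ∧ k ^ N ∈ P :=
      ⟨hP (Ideal.subset_span (by simp)), hP (Ideal.subset_span (by simp))⟩
    rcases hf (show (⟨P, hprime⟩ : PrimeSpectrum (Coord I)) ∈ bas f from hfP) with h1 | h1
    · exact h1 (hprime.mem_of_pow_mem _ hle.1)
    · exact h1 (hprime.mem_of_pow_mem _ hle.2)
  obtain ⟨L, hL⟩ := hrad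
  obtain ⟨a, b, hab⟩ := Ideal.mem_span_pair.1 hL
  exact ⟨L, a, b, hab⟩

/-- Partition of unity: from `a h^N + b k^N = f^L` one gets `m / (hk)^N = b m / (f^L h^N) + a m /
(f^L k^N)`, and `f` is invertible on both members of the cover. -/
lemma sectionsDecompose_dchSheaf (I : Type) : SectionsDecompose (DchSheaf I) := by
  intro h k f hh hk hf z
  obtain ⟨N, m, hm⟩ : ∃ (N : ℕ) (m : Dch I), z = constSec m ((h * k) ^ N) (bas h ⊓ bas k)
      ((bas_mul h k).ge.trans (bas_le_bas_pow _ N)) := by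
    obtain ⟨N, m, hm⟩ := exists_constSec (h * k) (res _ (bas_mul h k).le z)
    refine ⟨N, m, ?_⟩
    have := congrArg (res _ (bas_mul h k).ge) hm
    rwa [res_res, res_self] at this
  obtain ⟨L, a, b, hab⟩ := exists_pow_eq_of_bas_le hf N
  have hle (g : Coord I) (hg : bas g ≤ bas f) : bas g ≤ bas (f ^ L * g ^ N) := fun p hp =>
    (primeCompl p).mul_mem (pow_mem (S := primeCompl p) (hg hp) L)
      (pow_mem (S := primeCompl p) hp N)
  refine ⟨constSec (b • m) _ _ (hle h hh), constSec (a • m) _ _ (hle k hk), ?_⟩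
  rw [hm, res_constSec, res_constSec]
  refine dchSec_ext fun p => ?_
  change (LocalizedModule.mk m _ : DchLoc (primeCompl p.1)) =
    LocalizedModule.mk (b • m) _ + LocalizedModule.mk (a • m) _
  rw [LocalizedModule.mk_add_mk]
  refine LocalizedModule.mk_eq.2 ⟨1, ?_⟩
  simp only [Submonoid.smul_def, one_smul, Submonoid.coe_mul, smul_smul, ← add_smul]
  congr 1
  linear_combination (- (f ^ L * h ^ N * k ^ N)) * hab

/-- The section over `V ⊆ {f ≠ 0}` defined by an element of `D^ch[f⁻¹]`. -/
def locToSec (f : Coord I) (V : Opens (Aff I)) (hV : V ≤ bas f) :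
    DchLoc (Submonoid.powers f) →ₗ[ℂ] Sec (DchSheaf I) V :=
  have hle (p : V) : Submonoid.powers f ≤ primeCompl p.1 := Submonoid.powers_le.2 (hV p.2)
  { toFun y := (⟨fun p => (exists_locMap (hle p)).choose y, by
      obtain ⟨N, m, rfl⟩ := exists_fraction f y
      exact fun p => ⟨V, p.2, 𝟙 _, m, f ^ N, fun q => ⟨bas_le_bas_pow f N (hV q.2),
        (exists_locMap (hle q)).choose_spec m _⟩⟩⟩ : DchSections V)
    map_add' y z := dchSec_ext fun p => map_add _ y z
    map_smul' c y := dchSec_ext fun p => map_smul (exists_locMap (hle p)).choose c y }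

lemma locToSec_fraction (f : Coord I) (V : Opens (Aff I)) (hV : V ≤ bas f) (N : ℕ) (m : Dch I) :
    locToSec f V hV (fraction f N m) =
      constSec m (f ^ N) V (hV.trans (bas_le_bas_pow f N)) :=
  dchSec_ext fun p => (exists_locMap (Submonoid.powers_le.2 (hV p.2))).choose_spec m _

lemma locToSec_bijective (f : Coord I) (V : Opens (Aff I)) (hV : V = bas f) :
    Function.Bijective (locToSec f V hV.le) := by
  subst hV
  refine ⟨(injective_iff_map_eq_zero _).2 fun y hy => ?_, fun s => ?_⟩
  · obtain ⟨N, m, rfl⟩ := exists_fraction f y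
    rw [locToSec_fraction] at hy
    obtain ⟨u, hu⟩ := exists_pow_smul_eq_zero hy
    rw [← fraction_pow_smul f N u, hu, map_zero]
  · obtain ⟨N, m, rfl⟩ := exists_constSec f s
    exact ⟨fraction f N m, locToSec_fraction f _ _ N m⟩

/-- Compared stalk by stalk: the localization maps commute with the generating fields, hence with
every `a_(n)`. -/
lemma locToSec_act [LinearOrder I] (f : Coord I) (V : Opens (Aff I)) (hV : V ≤ bas f) (a : Dch I) (n : ℤ)
    (y : DchLoc (Submonoid.powers f)) :
    locToSec f V hV (act (locField _) a n y) = secMap (sheafAct a n) V (locToSec f V hV y) :=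
  dchSec_ext fun p => by
    have hle : Submonoid.powers f ≤ primeCompl p.1 := Submonoid.powers_le.2 (hV p.2)
    exact act_comm (locField (Submonoid.powers f)) (locField (primeCompl p.1))
      (exists_locMap hle).choose (fun g n y => by
        rw [locField, locField, ncoeff_ofModes, ncoeff_ofModes]
        exact locMode_comp _ hle (exists_locMap hle).choose_spec g n y) a n y

end SheafSections

/-! ### Extendable sections -/

section Extendable

variable {X : TopCat.{0}} {ι : Type} (U : ι → Opens X)

lemma mem_interList (l : List ι) (V : Opens X) (x : X) :
    x ∈ interList U l V ↔ x ∈ V ∧ ∀ j ∈ l, x ∈ U j := by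
  induction l generalizing V with
  | nil => simp [interList]
  | cons i l ih =>
    rw [interList, ih]
    simp [and_assoc]

variable (F : TopCat.Sheaf (ModuleCat.{0} ℂ) X)

/-- With `extendable_le`, this characterizes the recursively defined `extendable` without reference
to the order of the list: only an open set containing the intersection of all but one `U i` matters.
-/
lemma res_mem_extendable (l : List ι) (V : Opens X) {i : ι} (hi : i ∈ l) {O : Opens X}
    (h : interList U l V ≤ O) (hO : ∀ x ∈ V, (∀ j ∈ l, j ≠ i → x ∈ U j) → x ∈ O) (s : Sec F O) :
    res F h s ∈ extendable U F l V := by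
  induction l generalizing V with
  | nil => simp at hi
  | cons j l ih =>
    rcases List.mem_cons.1 hi with rfl | hi
    · refine Submodule.mem_sup_left ?_
      have hle : interList U l V ≤ O := fun x hx => by
        obtain ⟨hxV, hx⟩ := (mem_interList U l V x).1 hx
        exact hO x hxV fun j hj hji => hx j ((List.mem_cons.1 hj).resolve_left hji)
      exact ⟨res F hle s, res_res _ _ _ _⟩
    · refine Submodule.mem_sup_right (ih (V ⊓ U j) hi h fun x hx hx' => hO x hx.1 fun k hk hki => ?_)
      rcases List.mem_cons.1 hk with rfl | hk
      · exact hx.2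
      · exact hx' k hk hki

lemma extendable_le {l : List ι} (hl : l.Nodup) (V : Opens X)
    (K : Submodule ℂ (Sec F (interList U l V)))
    (hK : ∀ i ∈ l, ∀ (O : Opens X) (h : interList U l V ≤ O),
      (∀ x ∈ V, (∀ j ∈ l, j ≠ i → x ∈ U j) → x ∈ O) → ∀ s : Sec F O, res F h s ∈ K) :
    extendable U F l V ≤ K := by
  induction l generalizing V with
  | nil => exact bot_le
  | cons i l ih =>
    refine sup_le ?_ (ih hl.of_cons _ _ fun i' hi' O h hO s => ?_)
    · rintro _ ⟨s, rfl⟩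
      refine hK i List.mem_cons_self _ _ (fun x hx h => ?_) s
      exact (mem_interList U l V x).2 ⟨hx, fun j hj => h j (List.mem_cons_of_mem _ hj) (by
        rintro rfl
        exact hl.notMem hj)⟩
    · refine hK i' (List.mem_cons_of_mem _ hi') O h (fun x hx hx' => hO x ⟨hx, ?_⟩ ?_) s
      · refine hx' i List.mem_cons_self ?_
        rintro rfl
        exact hl.notMem hi'
      · exact fun j hj hji => hx' j (List.mem_cons_of_mem _ hj) hji

end Extendable

/-! ### The comparison of local cohomology with the vertex dual -/

section Comparison

variable {I : Type}

/-- The open set where the `i`-th coordinate is invertible. -/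
def coordOpen (i : I) : Opens (Aff I) := bas (MvPolynomial.X i : Coord I)

lemma top_eq_bas_one (I : Type) : (⊤ : Opens (Aff I)) = bas (1 : Coord I) :=
  PrimeSpectrum.basicOpen_one.symm

lemma mem_bas_prod (s : Finset I) (p : Aff I) :
    p ∈ bas (∏ i ∈ s, (MvPolynomial.X i : Coord I)) ↔ ∀ i ∈ s, p ∈ coordOpen i := by
  classical
  induction s using Finset.induction_on with
  | empty =>
    rw [Finset.prod_empty, ← top_eq_bas_one]
    simp
  | insert i s hi ih =>
    rw [Finset.prod_insert hi, bas_mul, Opens.mem_inf, ih, Finset.forall_mem_insert]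
    rfl

lemma compl_origin (l : List I) (hl : ∀ i, i ∈ l) :
    (origin I).compl = ⨆ i : {i // i ∈ l}, coordOpen i.1 := by
  ext p
  rw [SetLike.mem_coe, SetLike.mem_coe, Opens.mem_iSup]
  change ¬ (Set.range MvPolynomial.X ⊆ (p.asIdeal : Set (Coord I))) ↔ _
  rw [Set.range_subset_iff, not_forall]
  exact ⟨fun ⟨i, hi⟩ => ⟨⟨i, hl i⟩, hi⟩, fun ⟨i, hi⟩ => ⟨i.1, hi⟩⟩

/-- Both spaces are quotients of `V` by the same kernel. Equivariance is tested on images of `V`, so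
nothing is required of `α` beyond compatibility with the two maps. -/
lemma moduleIso_of_surjective {V W W' : Type} [AddCommGroup V] [Module ℂ V] [AddCommGroup W]
    [Module ℂ W] [AddCommGroup W'] [Module ℂ W'] {α : Dch I → ℤ → Module.End ℂ V}
    {ρ : Dch I → ℤ → Module.End ℂ W} {ρ' : Dch I → ℤ → Module.End ℂ W'} {f : V →ₗ[ℂ] W}
    {f' : V →ₗ[ℂ] W'} (hf : Function.Surjective f) (hf' : Function.Surjective f')
    (hker : LinearMap.ker f = LinearMap.ker f') (h : ∀ a n v, f (α a n v) = ρ a n (f v))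
    (h' : ∀ a n v, f' (α a n v) = ρ' a n (f' v)) : ModuleIso ρ ρ' := by
  let e := (f.quotKerEquivOfSurjective hf).symm ≪≫ₗ Submodule.quotEquivOfEq _ _ hker ≪≫ₗ
    f'.quotKerEquivOfSurjective hf'
  have he (v : V) : e (f v) = f' v := by
    have : (f.quotKerEquivOfSurjective hf).symm (f v) = Submodule.Quotient.mk v :=
      (LinearEquiv.symm_apply_eq _).2 rfl
    simp only [e, LinearEquiv.trans_apply, this]
    rfl
  refine ⟨e, fun a n w => ?_⟩
  obtain ⟨v, rfl⟩ := hf w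
  rw [← h, he, he, h']

lemma ModuleIso.symm {W W' : Type} [AddCommMonoid W] [Module ℂ W] [AddCommMonoid W'] [Module ℂ W']
    {ρ : Dch I → ℤ → Module.End ℂ W} {ρ' : Dch I → ℤ → Module.End ℂ W'} (h : ModuleIso ρ ρ') :
    ModuleIso ρ' ρ := by
  obtain ⟨e, he⟩ := h
  exact ⟨e.symm, fun a n w => by rw [LinearEquiv.symm_apply_eq, he, e.apply_symm_apply]⟩

lemma ModuleIso.trans {W W' W'' : Type} [AddCommMonoid W] [Module ℂ W] [AddCommMonoid W']
    [Module ℂ W'] [AddCommMonoid W''] [Module ℂ W''] {ρ : Dch I → ℤ → Module.End ℂ W}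
    {ρ' : Dch I → ℤ → Module.End ℂ W'} {ρ'' : Dch I → ℤ → Module.End ℂ W''}
    (h : ModuleIso ρ ρ') (h' : ModuleIso ρ' ρ'') : ModuleIso ρ ρ'' := by
  obtain ⟨e, he⟩ := h
  obtain ⟨e', he'⟩ := h'
  exact ⟨e.trans e', fun a n w => by simp [he, he']⟩

variable [Fintype I]

lemma interList_coordOpen (l : List I) (hl : ∀ i, i ∈ l) :
    interList coordOpen l ⊤ = bas (coordProd I) := by
  ext p
  rw [SetLike.mem_coe, SetLike.mem_coe, mem_interList, coordProd, mem_bas_prod]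
  simp [hl]

/-- Both conditions say that the fraction is a sum of fractions each regular in one coordinate:
regularity in `x_i` means that the numerator over `(∏ x_j)^N` can be taken divisible by `x_i^N`,
that is, that the section extends to the locus where the other coordinates are invertible. -/
lemma locToSec_mem_extendable (l : List I) (hl : ∀ i, i ∈ l) (hn : l.Nodup)
    (y : DchLoc (Submonoid.powers (coordProd I))) :
    locToSec (coordProd I) _ (interList_coordOpen l hl).le y ∈
      extendable coordOpen (DchSheaf I) l ⊤ ↔ toDual I y = 0 := by
  classical
  have hW := interList_coordOpen l hl
  have hbij := locToSec_bijective (coordProd I) _ hW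
  have hprod (i : I) : MvPolynomial.X i * (∏ j ∈ Finset.univ.erase i, MvPolynomial.X j) =
      coordProd I := Finset.mul_prod_erase _ _ (Finset.mem_univ i)
  have hle (i : I) : interList coordOpen l ⊤ ≤
      bas (∏ j ∈ Finset.univ.erase i, (MvPolynomial.X j : Coord I)) := by
    rw [hW, ← hprod i, bas_mul]
    exact inf_le_right
  have hsec (i : I) (N : ℕ) (m : Dch I) :
      locToSec (coordProd I) _ hW.le (fraction _ N ((MvPolynomial.X i : Coord I) ^ N • m)) =
        res (DchSheaf I) (hle i) (constSec m ((∏ j ∈ Finset.univ.erase i, MvPolynomial.X j) ^ N) _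
          (bas_le_bas_pow _ N)) := by
    rw [locToSec_fraction, res_constSec]
    refine dchSec_ext fun p => LocalizedModule.mk_eq.2 ⟨1, ?_⟩
    simp only [Submonoid.smul_def, one_smul, smul_smul, ← hprod i, mul_pow]
    congr 1
    ring
  constructor
  · intro h
    have hK : extendable coordOpen (DchSheaf I) l ⊤ ≤
        (LinearMap.ker (toDual I)).map (locToSec (coordProd I) _ hW.le) := by
      refine extendable_le coordOpen _ hn _ _ fun i _ O hO hO' s => ?_
      have hbas : bas (∏ j ∈ Finset.univ.erase i, (MvPolynomial.X j : Coord I)) ≤ O := fun p hp =>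
        hO' p trivial fun j _ hji => (mem_bas_prod _ p).1 hp j (by simp [hji])
      obtain ⟨N, m, hm⟩ := exists_constSec _ (res _ hbas s)
      refine ⟨fraction _ N ((MvPolynomial.X i : Coord I) ^ N • m),
        toDual_fraction_X_pow_smul N i m, ?_⟩
      rw [hsec, ← hm, res_res]
    obtain ⟨z, hz, hzy⟩ := hK h
    rw [← hbij.1 hzy]
    exact hz
  · intro h
    obtain ⟨N, m, rfl⟩ := exists_fraction _ y
    refine fraction_mem_of_toDual_eq_zero h
      ((extendable coordOpen (DchSheaf I) l ⊤).comap (locToSec (coordProd I) _ hW.le))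
      fun p b i hi => ?_
    have hp : complexBasis I (p, b) = (MvPolynomial.X i : Coord I) ^ N •
        complexBasis I (p - Finsupp.single i N, b) := by
      rw [X_pow_smul_complexBasis, add_tsub_cancel_of_le (Finsupp.single_le_iff.2 hi)]
    rw [Submodule.mem_comap, hp, hsec]
    refine res_mem_extendable coordOpen _ l ⊤ (hl i) _ (fun q _ hq => ?_) _
    exact (mem_bas_prod _ q).2 fun j hj => hq j (hl j) (Finset.ne_of_mem_erase hj)

variable [LinearOrder I]

lemma isZero_rightDerived_top (I : Type) (k : ℕ) :
    Limits.IsZero (((sections (⊤ : Opens (Aff I))).rightDerived (k + 1)).obj (DchSheaf I)) := by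
  rw [top_eq_bas_one]
  exact (sectionsDecompose_dchSheaf I).isZero_rightDerived 1 k

lemma moduleIso_dual_localCoh_length (l : List I) (hl : ∀ i, i ∈ l) (hn : l.Nodup) :
    ModuleIso (I := I) dualAct (localCohAct l.length) := by
  let ψ : sections (interList coordOpen l ⊤) ⟶ localCoh (origin I) l.length :=
    iteratedδ coordOpen l ⊤ ≫
      (rightDerivedIso (supportIso coordOpen l (origin I) (compl_origin l hl)) l.length).inv
  have hδ := iteratedδ_surjective_and_ker coordOpen (F := DchSheaf I)
    (𝓑 := Set.range (bas : Coord I → Opens (Aff I)))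
    (by
      rintro _ ⟨f, rfl⟩ i
      exact ⟨f * MvPolynomial.X i, bas_mul _ _⟩)
    (by
      rintro _ ⟨f, rfl⟩ k
      exact (sectionsDecompose_dchSheaf I).isZero_rightDerived f k) l ⟨1, (top_eq_bas_one I).symm⟩
  have hiso : Function.Bijective ((rightDerivedIso
      (supportIso coordOpen l (origin I) (compl_origin l hl)) l.length).inv.app (DchSheaf I)).hom :=
    (ConcreteCategory.isIso_iff_bijective _).1 inferInstance
  have hW := interList_coordOpen l hl
  have hbij := locToSec_bijective (coordProd I) _ hW
  refine moduleIso_of_surjective (W := VertexDual I) (f := toDual I)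
    (f' := (ψ.app (DchSheaf I)).hom ∘ₗ locToSec (coordProd I) _ hW.le) (α := act (locField _))
    (ρ := dualAct) toDual_surjective ((hiso.2.comp hδ.1).comp hbij.2) ?_
    (fun a n y => toDual_act a n y) fun a n y => ?_
  · ext y
    rw [LinearMap.mem_ker, LinearMap.mem_ker, ← locToSec_mem_extendable l hl hn, ← hδ.2,
      LinearMap.mem_ker]
    exact (map_eq_zero_iff _ hiso.1).symm
  -- Equivariance of the cohomological map is naturality of `ψ` at the sheaf endomorphism `sheafAct
  -- a n`.
  · have hnat := congrArg (fun t => t.hom (locToSec (coordProd I) _ hW.le y))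
      (ψ.naturality (sheafAct a n))
    rw [LinearMap.comp_apply, locToSec_act]
    exact hnat

theorem moduleIso_dual_localCoh (I : Type) [Fintype I] [LinearOrder I] :
    ModuleIso (I := I) dualAct (localCohAct (Fintype.card I)) := by
  have h := moduleIso_dual_localCoh_length (Finset.univ : Finset I).toList (by simp)
    (Finset.nodup_toList _)
  rwa [Finset.length_toList, Finset.card_univ] at h

lemma moduleIso_coh_localCoh (I : Type) [LinearOrder I] (k : ℕ) :
    ModuleIso (I := I) (cohAct (k + 1)) (localCohAct (k + 2)) :=
  ⟨LinearEquiv.ofBijective _ (supportδ_bijective (origin I) k (isZero_rightDerived_top I)),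
    fun a n w => congrArg (fun t => t.hom w) ((supportδ (origin I) (k + 1)).naturality (sheafAct a n))⟩

end Comparison

end ChiralDO

end

theorem lemma4p3p1 (I : Type) [Fintype I] [LinearOrder I] :
    ChiralDO.ModuleIso (I := I) ChiralDO.dualAct (ChiralDO.localCohAct (Fintype.card I)) ∧
    (1 < Fintype.card I →
      ChiralDO.ModuleIso (I := I) ChiralDO.dualAct (ChiralDO.cohAct (Fintype.card I - 1)) ∧
      ChiralDO.ModuleIso (I := I) (ChiralDO.localCohAct (Fintype.card I))
        (ChiralDO.cohAct (Fintype.card I - 1))) := by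
  refine ⟨ChiralDO.moduleIso_dual_localCoh I, fun h => ?_⟩
  have hdual := ChiralDO.moduleIso_dual_localCoh I
  -- The hypothesis means `2 ≤ Fintype.card I`, so the cardinality is `k + 2` and the degree on `U`
  -- reduces to `k + 1`, positive as the connecting isomorphism requires.
  obtain ⟨k, hk⟩ := Nat.exists_eq_add_of_le' h
  rw [hk] at hdual ⊢
  have hcoh := (ChiralDO.moduleIso_coh_localCoh I k).symm
  exact ⟨hdual.trans hcoh, hcoh⟩
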